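/- **Setting.** Let $\alpha>0$, let $T$ be a separable metric space with Borel $\sigma$-algebra $\mathcal T$, and let $\lambda$ be a $\sigma$-finite Borel measure on $T$. Let $L^0_+(T,\lambda)$ be the set of non-negative finite measurable functions on $T$, modulo $\lambda$-a.e. equality. A set $\mathcal P\subset L^0_+(T,\lambda)$ is a *positive cone* if $c\mathcal P\subset\mathcal P$ for all $c\ge 0$; two cones are *disjoint* if their intersection is $\{0\}$. A random variable $Z\in[0,\infty]$ is *$\alpha$-Fréchet with scale* $\sigma\in[0,\infty]$ if $\mathbb P(Z\le x)=\exp\{-\sigma^\alpha x^{-\alpha}\}$ for $0<x<\infty$ ($\sigma=0$ means $Z=0$ a.s. and $\sigma=\infty$ means $Z=\infty$ a.s.). A process $\{Y_t\}_{t\in T}$ is an *$\alpha$-Fréchet process* if all $\bigvee_{i\le m}a_iY_{t_i}$ ($m\ge 1$, $a_i>0$, $t_i\in T$) are $\alpha$-Fréchet with finite scale (scale $0$ is allowed). An *$\alpha$-Fréchet random sup-measure* $M$ on a measure space $(S,\mu)$ is a family $\{M(A)\}$ of $[0,\infty]$-valued random variables, indexed by the measurable $A\subset S$, such that the $M(A_i)$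 are independent for finitely many disjoint $A_i$, $M(A)$ is $\alpha$-Fréchet with scale $\mu(A)^{1/\alpha}$, and $M(\bigcup_iA_i)=\bigvee_iM(A_i)$ a.s. for every sequence of disjoint $A_i$. The *extremal integral* of a simple $\varphi\ge 0$ is $\int^e\varphi\,dM=\bigvee_a a\,M(\{\varphi=a\})$. It extends by continuity to measurable $f\ge0$ with $\int f^\alpha d\mu<\infty$ (as the a.s. limit of $\int^e\varphi_m\,dM$ for simple $\varphi_m\uparrow f$), and $\int^e_A f\,dM=\int^e 1_Af\,dM$. A *jointly measurable representation* of a process $X=\{X_t\}_{t\in T}$ consists of a standard Borel space $S$ with a $\sigma$-finite measure $\mu$, an $\alpha$-Fréchet random sup-measure $M$ on $(S,\mu)$, and a jointly measurable $(t,s)\mapsto f_t(s)\in[0,\infty)$ with $\int f_t^\alpha d\mu<\infty$ for all $t$, such that $\{X_t\}_{t\in T}\overset d=\{\int^e_S f_t\,dM\}_{t\in T}$; here $\overset d=$ is equality of finite-dimensional distributions. It has *full support* if the closure of $\{\bigvee_{i\le m}a_if_{t_i}: m\ge1,\ a_i>0,\ t_i\in T\}$ in the metric $\int|f^\alpha-g^\alpha|\,d\mu$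 on $\{f\ge 0:\int f^\alpha d\mu<\infty\}$ contains a function that is non-zero $\mu$-a.e. A *co-spectral decomposition* with respect to $\mathcal P_1,\dots,\mathcal P_n\subset L_+^0(T,\lambda)$ consists of measurable sets $S^{(1)},\dots,S^{(n)}\subset S$ such that $f_\cdot(s)\in\mathcal P_j$ for all $s\in S^{(j)}$ and $\mu(S\setminus\bigcup_jS^{(j)})=0$; put $X^{(j)}_t=\int^e_{S^{(j)}}f_t\,dM$. **Theorem.** Let $X=\{X_t\}_{t\in T}$ be an $\alpha$-Fréchet process, and let $(S,\mu,M,f)$ and $(\hat S,\hat\mu,\hat M,\hat f)$ be any two jointly measurable representations of $X$. (A) Let $\mathcal P_1,\dots,\mathcal P_n$ be pairwise disjoint positive cones in $L^0_+(T,\lambda)$. Suppose that both representations have full support and, if $n\ge2$, that for $\mu$-a.e. $s$ the function $f_\cdot(s)$ is not $\lambda$-a.e. zero. Suppose that $(S,\mu,M,f)$ has a co-spectral decomposition $S^{(1)},\dots,S^{(n)}$ with respect to $\mathcal P_1,\dots,\mathcal P_n$. Then 1. $\{X_t\}_{t\in T}\overset d=\{X^{(1)}_t\vee\dots\vee X^{(n)}_t\}_{t\in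 T}$, and the processes $X^{(1)},\dots,X^{(n)}$ are independent $\alpha$-Fréchet processes; 2. $(\hat S,\hat\mu,\hat M,\hat f)$ also has a co-spectral decomposition with respect to $\mathcal P_1,\dots,\mathcal P_n$; 3. for every co-spectral decomposition $\hat S^{(1)},\dots,\hat S^{(n)}$ of $(\hat S,\hat\mu,\hat M,\hat f)$, with $\hat X^{(j)}_t=\int^e_{\hat S^{(j)}}\hat f_t\,d\hat M$, one has $\{X^{(j)}_t\}_{t\in T}\overset d=\{\hat X^{(j)}_t\}_{t\in T}$ for $j=1,\dots,n$. (B) (Conservative–dissipative decomposition.) Let $C=\{s:\int_Tf_t(s)^\alpha\lambda(dt)=\infty\}$ and $D=\{s:\int_Tf_t(s)^\alpha\lambda(dt)<\infty\}$. Then $C,D$ is a co-spectral decomposition with respect to $\{0\}\cup\{g:\int g^\alpha d\lambda=\infty\}$ and $\{g:\int g^\alpha d\lambda<\infty\}$. The processes $X^C_t=\int^e_Cf_t\,dM$ and $X^D_t=\int^e_Df_t\,dM$ are independent $\alpha$-Fréchet processes with $\{X_t\}\overset d=\{X_t^C\vee X_t^D\}$, and their laws do not change if $(S,\mu,M,f)$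 is replaced by $(\hat S,\hat\mu,\hat M,\hat f)$. (C) (Positive–null decomposition.) Let $T$ be $\mathbb R$ or $\mathbb Z$ (or carry the structure of any linearly ordered abelian group). Let $\mathcal W$ be the class of measurable $w:T\to(0,\infty)$ with $\int w\,d\lambda=\infty$ such that $t\mapsto w(t)$ and $t\mapsto w(-t)$ are non-increasing on $\{t>0\}$ (the same holds with non-decreasing in place of non-increasing), and assume that $\mathcal W\ne\emptyset$, as is the case for Lebesgue measure on $\mathbb R$ and counting measure on $\mathbb Z$. Let $\mathcal P_{\rm pos}=\{g:\int w\,g^\alpha d\lambda=\infty\ \text{for all } w\in\mathcal W\}$ and $\mathcal P_{\rm null}=\{0\}\cup(L_+^0(T,\lambda)\setminus\mathcal P_{\rm pos})$. Suppose that there are measurable $P,N\subset S$ with $\mu(S\setminus(P\cup N))=0$, $f_\cdot(s)\in\mathcal P_{\rm pos}$ for $s\in P$ and $f_\cdot(s)\in\mathcal P_{\rm null}$ for $s\in N$. Then $X^{\rm pos}_t=\int^e_Pf_t\,dM$ and $X^{\rm null}_t=\int^e_Nf_t\,dM$ are independent $\alpha$-Fréchet processes with $\{X_t\}\overset d=\{X_t^{\rm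 pos}\vee X_t^{\rm null}\}$. Sets $\hat P,\hat N\subset\hat S$ with the corresponding properties for $\hat f,\hat\mu$ exist, and any such sets give components with the same laws as $X^{\rm pos}$ and $X^{\rm null}$. -/

import Mathlib

open MeasureTheory ProbabilityTheory Set
open scoped NNReal ENNReal

noncomputable section

namespace FrechetProcess

/-! ### Fréchet laws, Fréchet processes, random sup-measures -/

/-- `Z` is `α`-Fréchet with scale coefficient `σ ∈ [0, ∞]`:
`P (Z ≤ x) = exp (-(σ / x) ^ α)` for all `x ∈ (0, ∞)`.
The degenerate scales mean `Z = 0` a.s. (`σ = 0`) and `Z = ∞` a.s. (`σ = ∞`). -/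
def HasFrechetLaw {Ω : Type*} [MeasurableSpace Ω] (P : Measure Ω) (α : ℝ) (σ : ℝ≥0∞)
    (Z : Ω → ℝ≥0∞) : Prop :=
  ∀ x : ℝ≥0, 0 < x → P {ω | Z ω ≤ x} = EReal.exp (-(((σ / x) ^ α : ℝ≥0∞) : EReal))

/-- `Y = {Y_t}` is an `α`-Fréchet process: every positive max-linear combination
`⋁ i, a i • Y (t i)` (over a non-empty finite index set) is `α`-Fréchet with a finite scale
coefficient. In particular every `Y t` is finite almost surely. -/
def IsFrechetProcess {T Ω : Type*} [MeasurableSpace Ω] (P : Measure Ω) (α : ℝ)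
    (Y : T → Ω → ℝ≥0∞) : Prop :=
  (∀ t, Measurable (Y t)) ∧
  ∀ (m : ℕ) (a : Fin (m + 1) → ℝ≥0) (t : Fin (m + 1) → T), (∀ i, 0 < a i) →
    ∃ σ : ℝ≥0, HasFrechetLaw P α σ (fun ω => ⨆ i, (a i : ℝ≥0∞) * Y (t i) ω)

/-- `M` is an `α`-Fréchet random sup-measure on `S` with control measure `μ`. -/
structure IsFrechetSupMeasure {S Ω : Type*} [MeasurableSpace S] [MeasurableSpace Ω]
    (P : Measure Ω) (α : ℝ) (μ : Measure S) (M : Set S → Ω → ℝ≥0∞) : Prop where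
  measurable : ∀ A, MeasurableSet A → Measurable (M A)
  indep : ∀ (m : ℕ) (A : Fin m → Set S), (∀ i, MeasurableSet (A i)) →
    Pairwise (fun i j => Disjoint (A i) (A j)) → iIndepFun (fun i => M (A i)) P
  law : ∀ A, MeasurableSet A → HasFrechetLaw P α ((μ A) ^ (1 / α)) (M A)
  iUnion : ∀ A : ℕ → Set S, (∀ i, MeasurableSet (A i)) →
    Pairwise (fun i j => Disjoint (A i) (A j)) →
    M (⋃ i, A i) =ᵐ[P] fun ω => ⨆ i, M (A i) ω

/-! ### Extremal integrals -/

/-- The extremal integral `⋁ a, a • M {φ = a}` of a simple function `φ`. -/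
def simpleExtremalIntegral {S Ω : Type*} [MeasurableSpace S] (M : Set S → Ω → ℝ≥0∞)
    (φ : SimpleFunc S ℝ≥0∞) (ω : Ω) : ℝ≥0∞ :=
  φ.range.sup fun a => a * M (φ ⁻¹' {a}) ω

/-- The extremal integral of a measurable `f ≥ 0`, as the supremum of the extremal integrals of
the canonical simple functions `eapprox f n ↑ f`. When `∫ f ^ α dμ < ∞`, these integrals are
a.s. non-decreasing in `n` and `∫ |f ^ α - (eapprox f n) ^ α| dμ → 0`, so this is (a version of)
the extension of the extremal integral by continuity in probability. -/
def extremalIntegral {S Ω : Type*} [MeasurableSpace S] (M : Set S → Ω → ℝ≥0∞)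
    (f : S → ℝ≥0∞) (ω : Ω) : ℝ≥0∞ :=
  ⨆ n, simpleExtremalIntegral M (SimpleFunc.eapprox f n) ω

/-- The process `t ↦ ∫ᵉ_A f_t dM` of extremal integrals over the set `A`. -/
def extremalProcess {T S Ω : Type*} [MeasurableSpace S] (M : Set S → Ω → ℝ≥0∞)
    (f : T → S → ℝ≥0) (A : Set S) (t : T) (ω : Ω) : ℝ≥0∞ :=
  extremalIntegral M (A.indicator fun s => (f t s : ℝ≥0∞)) ω

/-- The processes `Y` and `Z` (possibly on different probability spaces) are equal in
distribution; on the product `σ`-algebra of `T → [0, ∞]` this is equality of all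
finite-dimensional distributions. -/
def EqualInLaw {T Ω Ω' : Type*} [MeasurableSpace Ω] [MeasurableSpace Ω']
    (P : Measure Ω) (P' : Measure Ω') (Y : T → Ω → ℝ≥0∞) (Z : T → Ω' → ℝ≥0∞) : Prop :=
  IdentDistrib (fun ω t => Y t ω) (fun ω t => Z t ω) P P'

/-- `{f_t}` is a jointly measurable spectral representation of the process `X`, realised by the
random sup-measure `M` with control measure `μ`. -/
structure IsMeasurableRepresentation {T S Ω Ω' : Type*} [MeasurableSpace T] [MeasurableSpace S]
    [MeasurableSpace Ω] [MeasurableSpace Ω'] (α : ℝ) (P : Measure Ω) (X : T → Ω → ℝ≥0∞)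
    (μ : Measure S) (f : T → S → ℝ≥0) (P' : Measure Ω') (M : Set S → Ω' → ℝ≥0∞) : Prop where
  measurable : Measurable (Function.uncurry f)
  integrable : ∀ t, ∫⁻ s, (f t s : ℝ≥0∞) ^ α ∂μ < ∞
  supMeasure : IsFrechetSupMeasure P' α μ M
  eqLaw : EqualInLaw P P' X (extremalProcess M f univ)

/-! ### Full support -/

/-- All finite positive max-linear combinations `⋁ i, a i • f (t i)` of the functions `f t`. -/
def maxLinearSpan {T S : Type*} (f : T → S → ℝ≥0) : Set (S → ℝ≥0) :=
  {g | ∃ (m : ℕ) (a : Fin (m + 1) → ℝ≥0) (t : Fin (m + 1) → T), (∀ i, 0 < a i) ∧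
    g = fun s => Finset.univ.sup fun i => a i * f (t i) s}

/-- The metric `∫ |f ^ α - g ^ α| dμ` on `L^α_+(S, μ)`. -/
def rhoDist {S : Type*} [MeasurableSpace S] (α : ℝ) (μ : Measure S) (f g : S → ℝ≥0) : ℝ≥0∞ :=
  ∫⁻ s, edist (f s ^ α) (g s ^ α) ∂μ

/-- `supp {f_t, t ∈ T} = S` modulo `μ`: the closed max-linear span of `{f_t}` in `L^α_+(S, μ)`
contains a function whose support is `S` up to a `μ`-null set. -/
def HasFullSupport {T S : Type*} [MeasurableSpace S] (α : ℝ) (μ : Measure S)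
    (f : T → S → ℝ≥0) : Prop :=
  ∃ f₀ : S → ℝ≥0, Measurable f₀ ∧ ∫⁻ s, (f₀ s : ℝ≥0∞) ^ α ∂μ < ∞ ∧
    (∀ ε : ℝ≥0∞, 0 < ε → ∃ g ∈ maxLinearSpan f, rhoDist α μ g f₀ < ε) ∧
    μ {s | f₀ s = 0} = 0

/-! ### Co-spectral functions and cones in `L^0_+(T, lam)` -/

/-- The co-spectral function `f_·(s)` as an element of `L^0_+(T, lam)`. -/
def coSpectral {T S : Type*} [MeasurableSpace T] [MeasurableSpace S] (lam : Measure T)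
    {f : T → S → ℝ≥0} (hf : Measurable (Function.uncurry f)) (s : S) : T →ₘ[lam] ℝ≥0 :=
  AEEqFun.mk (fun t => f t s)
    (hf.comp (measurable_id.prodMk measurable_const)).aestronglyMeasurable

/-- `K` is a positive cone in `L^0_+(T, lam)`: `c K ⊆ K` for all `c ≥ 0`. -/
def IsPositiveCone {T : Type*} [MeasurableSpace T] {lam : Measure T}
    (K : Set (T →ₘ[lam] ℝ≥0)) : Prop :=
  ∀ c : ℝ≥0, ∀ g ∈ K, c • g ∈ K

/-- The sets `A j` form a co-spectral decomposition of `S` with respect to the sets `K j`. -/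
structure IsCoSpectralDecomposition {T S : Type*} [MeasurableSpace T] [MeasurableSpace S]
    {lam : Measure T} (μ : Measure S) {f : T → S → ℝ≥0} (hf : Measurable (Function.uncurry f))
    {n : ℕ} (K : Fin n → Set (T →ₘ[lam] ℝ≥0)) (A : Fin n → Set S) : Prop where
  measurableSet : ∀ j, MeasurableSet (A j)
  mem : ∀ j, ∀ s ∈ A j, coSpectral lam hf s ∈ K j
  cover : μ (⋃ j, A j)ᶜ = 0

/-- `X = Y 0 ∨ ⋯ ∨ Y (n - 1)` in distribution, where the `Y j` are mutually independent
`α`-Fréchet processes. -/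
structure IsIndependentDecomposition {T Ω Ω' : Type*} [MeasurableSpace Ω] [MeasurableSpace Ω']
    (α : ℝ) (P : Measure Ω) (X : T → Ω → ℝ≥0∞) (P' : Measure Ω') {n : ℕ}
    (Y : Fin n → T → Ω' → ℝ≥0∞) : Prop where
  eqLaw : EqualInLaw P P' X (fun t ω => ⨆ j, Y j t ω)
  indep : iIndepFun (fun j ω t => Y j t ω) P'
  frechet : ∀ j, IsFrechetProcess P' α (Y j)

/-! ### The conservative-dissipative and positive-null decompositions -/

/-- The cone of functions with `∫ g ^ α dlam = ∞`, together with `0`. -/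
def conservativeCone {T : Type*} [MeasurableSpace T] (α : ℝ) (lam : Measure T) :
    Set (T →ₘ[lam] ℝ≥0) :=
  {0} ∪ {g | ∫⁻ t, (g t : ℝ≥0∞) ^ α ∂lam = ∞}

/-- The cone of functions with `∫ g ^ α dlam < ∞`. -/
def dissipativeCone {T : Type*} [MeasurableSpace T] (α : ℝ) (lam : Measure T) :
    Set (T →ₘ[lam] ℝ≥0) :=
  {g | ∫⁻ t, (g t : ℝ≥0∞) ^ α ∂lam < ∞}

/-- The partition of `S` into `C = {∫ f_t ^ α lam(dt) = ∞}` and `D = {∫ f_t ^ α lam(dt) < ∞}`. -/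
def consDissSets {T S : Type*} [MeasurableSpace T] (α : ℝ) (lam : Measure T)
    (f : T → S → ℝ≥0) : Fin 2 → Set S :=
  ![{s | ∫⁻ t, (f t s : ℝ≥0∞) ^ α ∂lam = ∞}, {s | ∫⁻ t, (f t s : ℝ≥0∞) ^ α ∂lam < ∞}]

/-- Positive weights with infinite integral such that `w t` and `w (-t)` are non-increasing
for `t > 0`. -/
def decreasingWeights {T : Type*} [MeasurableSpace T] [AddCommGroup T] [LinearOrder T]
    (lam : Measure T) : Set (T → ℝ≥0) :=
  {w | Measurable w ∧ (∀ t, 0 < w t) ∧ ∫⁻ t, (w t : ℝ≥0∞) ∂lam = ∞ ∧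
    AntitoneOn w (Ioi 0) ∧ AntitoneOn (fun t => w (-t)) (Ioi 0)}

/-- Positive weights with infinite integral such that `w t` and `w (-t)` are non-decreasing
for `t > 0`. -/
def increasingWeights {T : Type*} [MeasurableSpace T] [AddCommGroup T] [LinearOrder T]
    (lam : Measure T) : Set (T → ℝ≥0) :=
  {w | Measurable w ∧ (∀ t, 0 < w t) ∧ ∫⁻ t, (w t : ℝ≥0∞) ∂lam = ∞ ∧
    MonotoneOn w (Ioi 0) ∧ MonotoneOn (fun t => w (-t)) (Ioi 0)}

/-- The functions `g` with `∫ w g ^ α dlam = ∞` for all weights `w` in the class `𝒲`. -/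
def positiveCone {T : Type*} [MeasurableSpace T] (α : ℝ) (lam : Measure T)
    (𝒲 : Set (T → ℝ≥0)) : Set (T →ₘ[lam] ℝ≥0) :=
  {g | ∀ w ∈ 𝒲, ∫⁻ t, (w t : ℝ≥0∞) * (g t : ℝ≥0∞) ^ α ∂lam = ∞}

/-- The zero function together with all functions that are not in `positiveCone`. -/
def nullCone {T : Type*} [MeasurableSpace T] (α : ℝ) (lam : Measure T)
    (𝒲 : Set (T → ℝ≥0)) : Set (T →ₘ[lam] ℝ≥0) :=
  {0} ∪ (positiveCone α lam 𝒲)ᶜ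

end FrechetProcess

end

/-! Put `y t = f t ^ α`. For a finite set `I` and positive `c`, the event `X t ≤ c t` on `I` has
probability `exp (-∫ ⋁ c t ^ (-α) y t dμ)`. So the law of `X` determines the integrals of all
max-linear combinations of the `y t`, and any two representations share them
(`lintegral_maxLin_eq`). Likewise the law of the component over a set `A` is coded by the integrals
over `A`, that is, by the masses `tilted μ y I a A`. The task is to show that these masses are the
same in both representations when `A` is cut out by a cone.

For a max-linear `F`, the shared integrals determine the law of the normalised family `y t / F`
under the finite measure `F dμ` (`tiltedLaw_congr`): push `μ × Lebesgue` forward by `(s, u) ↦ y t s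
/ u` on `u < F s`; lower boxes then have masses that are differences of the known integrals.

A cone in `L⁰(lam)` sees only the `lam`-class of `t ↦ y t s`, not its values at individual points.
Joint measurability bridges the gap: the class is encoded by the countably many numbers `lam {t |
(t, g t s) ∈ W k}`, a point of the Hilbert cube, and by Fubini the mixed moments of these numbers
depend only on finite-dimensional laws (`map_graphCoord_congr`). Hence the normalised co-spectral
functions, as random elements of `L⁰(lam)`, have the same law in both representations.

It follows that a Borel set `A ⊆ S₁` has a counterpart in `S₂`, consisting of points whose
co-spectral functions are positive multiples of those over `A`, with at least the same tilted mass
(`exists_transfer`). Cones are blind to positive multiples, so transferring a cover gives existence,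
and transferring each piece in both directions gives equality of the masses. Independence within one
representation is the additivity of `A ↦ tilted μ y I a A` under the exponential. -/

noncomputable section

namespace FrechetProcess

/-! ### Borel images, moments on the Hilbert cube, countable generators. -/

/-- A measurable image of a Borel set contains a Borel set carrying all of its mass. -/
theorem exists_measurableSet_subset_image {X Y : Type*} [MeasurableSpace X] [StandardBorelSpace X]
    [TopologicalSpace Y] [T2Space Y] [SecondCountableTopology Y] [MeasurableSpace Y] [BorelSpace Y]
    (m : Measure X) [IsFiniteMeasure m] {J : X → Y} (hJ : Measurable J) {A : Set X}
    (hA : MeasurableSet A) :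
    ∃ B ⊆ J '' A, MeasurableSet B ∧ m (A \ J ⁻¹' B) = 0 := by
  obtain ⟨t, ht, htp⟩ := ‹StandardBorelSpace X›.polish
  -- A finer Polish topology with the same Borel sets makes `J` continuous, so the compact sets that
  -- exhaust `A` in measure have compact, hence Borel, images.
  obtain ⟨t', ht', hJc, hp⟩ := hJ.exists_continuous
  let := t'
  have : BorelSpace X := ⟨by
    rw [ht.measurable_eq]
    exact (borel_eq_borel_of_le hp htp ht').symm⟩
  have key : ∀ n : ℕ, ∃ K ⊆ A, IsCompact K ∧ m A < m K + ((n : ℝ≥0∞) + 1)⁻¹ := fun n =>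
    hA.exists_isCompact_lt_add (measure_ne_top m A) (by simp)
  choose K hKA hK hKm using key
  refine ⟨⋃ n, J '' K n, iUnion_subset fun n => image_mono (hKA n),
    MeasurableSet.iUnion fun n => ((hK n).image hJc).isClosed.measurableSet, ?_⟩
  refine le_antisymm (le_of_forall_pos_le_add fun ε hε => ?_) zero_le
  obtain ⟨n, hn⟩ := ENNReal.exists_inv_nat_lt hε.ne'
  calc m (A \ J ⁻¹' ⋃ n, J '' K n) ≤ m (A \ K n) := by
        refine measure_mono (sdiff_subset_sdiff_right fun x hx => ?_)
        exact mem_iUnion.2 ⟨n, mem_image_of_mem J hx⟩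
    _ = m A - m (K n) := measure_sdiff (hKA n) (hK n).isClosed.measurableSet.nullMeasurableSet
        (measure_ne_top _ _)
    _ ≤ ((n : ℝ≥0∞) + 1)⁻¹ := tsub_le_iff_left.2 (hKm n).le
    _ ≤ (n : ℝ≥0∞)⁻¹ := ENNReal.inv_le_inv.2 le_self_add
    _ ≤ 0 + ε := by rw [zero_add]; exact hn.le

/-- The `k`-th coordinate on the Hilbert cube. -/
def cubeCoord (k : ℕ) : BoundedContinuousFunction (ℕ → unitInterval) ℝ :=
  BoundedContinuousFunction.mkOfCompact ⟨fun x => (x k : ℝ), by fun_prop⟩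

@[simp] theorem cubeCoord_apply (k : ℕ) (x : ℕ → unitInterval) : cubeCoord k x = x k := rfl

/-- Finite measures on the Hilbert cube are determined by their mixed moments. -/
theorem ext_of_moments {m₁ m₂ : Measure (ℕ → unitInterval)} [IsFiniteMeasure m₁]
    [IsFiniteMeasure m₂]
    (h : ∀ l : List ℕ, ∫ x, (l.map fun k => (x k : ℝ)).prod ∂m₁
      = ∫ x, (l.map fun k => (x k : ℝ)).prod ∂m₂) : m₁ = m₂ := by
  let Φ : MvPolynomial ℕ ℝ →ₐ[ℝ] BoundedContinuousFunction (ℕ → unitInterval) ℝ :=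
    MvPolynomial.aeval cubeCoord
  let A : StarSubalgebra ℝ (BoundedContinuousFunction (ℕ → unitInterval) ℝ) :=
    { Φ.range with
      star_mem' := fun {a} ha => by
        have : star a = a := by ext x; simp
        rwa [this] }
  have hlist : ∀ (l : List ℕ) (x : ℕ → unitInterval),
      ((l.map cubeCoord).prod) x = (l.map fun k => (x k : ℝ)).prod := by
    intro l x
    induction l with
    | nil => simp
    | cons a l ih => simp [ih]
  refine ext_of_forall_mem_subalgebra_integral_eq_of_polish (𝕜 := ℝ) (A := A) ?_ ?_
  · intro x y hxy
    obtain ⟨k, hk⟩ := Function.ne_iff.1 hxy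
    refine ⟨fun x => x k, ⟨(cubeCoord k).toContinuousMap, ⟨cubeCoord k, ⟨MvPolynomial.X k, ?_⟩, rfl⟩, rfl⟩, ?_⟩
    · simp [Φ]
    · simpa [Subtype.ext_iff] using hk
  · rintro g ⟨p, rfl⟩
    -- The extra monomial `l` strengthens the induction: multiplication by a variable is absorbed by
    -- prolonging `l`.
    have : ∀ l : List ℕ, ∫ x, (Φ p * (l.map cubeCoord).prod) x ∂m₁
        = ∫ x, (Φ p * (l.map cubeCoord).prod) x ∂m₂ := by
      induction p using MvPolynomial.induction_on with
      | C a =>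
        intro l
        have : ∀ x, (Φ (MvPolynomial.C a) * (l.map cubeCoord).prod) x
            = a * (l.map fun k => (x k : ℝ)).prod := by
          intro x; rw [BoundedContinuousFunction.mul_apply, hlist]; simp [Φ]
        simp only [this, integral_const_mul, h l]
      | add p q hp hq =>
        intro l
        simp only [map_add, add_mul, BoundedContinuousFunction.add_apply]
        rw [integral_add (BoundedContinuousFunction.integrable _ _)
            (BoundedContinuousFunction.integrable _ _),
          integral_add (BoundedContinuousFunction.integrable _ _)
            (BoundedContinuousFunction.integrable _ _), hp l, hq l]
      | mul_X p n hp =>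
        intro l
        have := hp (n :: l)
        simpa [Φ, mul_assoc] using this
    simpa using this []

/-- A countably generated `σ`-algebra has a countable generating `π`-system. -/
theorem exists_seq_piSystem (X : Type*) [m : MeasurableSpace X]
    [MeasurableSpace.CountablyGenerated X] :
    ∃ W : ℕ → Set X, IsPiSystem (range W) ∧ m = MeasurableSpace.generateFrom (range W) := by
  obtain ⟨b, hb, hm⟩ := MeasurableSpace.CountablyGenerated.isCountablyGenerated (α := X)
  have hc := countable_generateSetAlgebra hb
  have hne : (generateSetAlgebra b).Nonempty := ⟨_, isSetAlgebra_generateSetAlgebra.empty_mem⟩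
  obtain ⟨W, hW⟩ := hc.exists_eq_range hne
  refine ⟨W, ?_, ?_⟩
  · rw [← hW]
    exact isSetAlgebra_generateSetAlgebra.isSetRing.isSetSemiring.isPiSystem
  · rw [← hW, generateFrom_generateSetAlgebra_eq, hm]

/-! ### Finite measures on `T → [0, ∞]` -/

/-- The `π`-system of lower boxes with positive finite corners in `T → [0, ∞]`. -/
def lowerBoxes (T : Type*) : Set (Set (T → ℝ≥0∞)) :=
  {B | ∃ (I : Finset T) (c : T → ℝ≥0), (∀ t, 0 < c t) ∧ B = {x : T → ℝ≥0∞ | ∀ t ∈ I, x t ≤ c t}}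

theorem isPiSystem_lowerBoxes (T : Type*) : IsPiSystem (lowerBoxes T) := by
  classical
  rintro _ ⟨I, c, hc, rfl⟩ _ ⟨J, d, hd, rfl⟩ -
  refine ⟨I ∪ J, fun t => if t ∈ I then (if t ∈ J then min (c t) (d t) else c t) else d t,
    fun t => ?_, ?_⟩
  · have := hc t
    have := hd t
    dsimp only
    split_ifs <;> simp_all
  · ext x
    simp only [mem_inter_iff, mem_ofPred_eq, Finset.mem_union]
    constructor
    · rintro ⟨h1, h2⟩ t ht
      split_ifs with hI hJ
      · simpa using ⟨h1 t hI, h2 t hJ⟩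
      · exact h1 t hI
      · exact h2 t (by tauto)
    · intro h
      refine ⟨fun t ht => ?_, fun t ht => ?_⟩
      · have := h t (Or.inl ht)
        simp only [ht, if_true] at this
        split_ifs at this
        · exact this.trans (by simp)
        · exact this
      · have := h t (Or.inr ht)
        simp only [ht, if_true] at this
        split_ifs at this
        · exact this.trans (by simp)
        · exact this

theorem measurableSet_of_mem_lowerBoxes {T : Type*} {B : Set (T → ℝ≥0∞)} (hB : B ∈ lowerBoxes T) :
    MeasurableSet B := by
  obtain ⟨I, c, -, rfl⟩ := hB
  simp only [ofPred_forall]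
  exact I.measurableSet_biInter fun t _ => measurableSet_le (measurable_pi_apply t) measurable_const

theorem measurable_of_Iic_pos {Ω : Type*} [MeasurableSpace Ω] {g : Ω → ℝ≥0∞}
    (h : ∀ c : ℝ≥0, 0 < c → MeasurableSet {ω | g ω ≤ c}) : Measurable g := by
  refine measurable_of_Iic fun a => ?_
  rcases eq_or_ne a ∞ with rfl | ha
  · simp
  -- Only positive corners are available, so the bound `a`, possibly `0`, is approached from above.
  have : g ⁻¹' Iic a = ⋂ n : ℕ, {ω | g ω ≤ ((a.toNNReal + ((n : ℝ≥0) + 1)⁻¹ : ℝ≥0) : ℝ≥0∞)} := by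
    ext ω
    simp only [mem_preimage, mem_Iic, mem_iInter, mem_ofPred_eq]
    constructor
    · intro h n
      refine h.trans ?_
      rw [ENNReal.coe_add, ENNReal.coe_toNNReal ha]
      exact le_self_add
    · intro h
      refine le_of_forall_pos_le_add fun ε hε => ?_
      obtain ⟨n, hn⟩ := ENNReal.exists_inv_nat_lt hε.ne'
      refine (h n).trans ?_
      rw [ENNReal.coe_add, ENNReal.coe_toNNReal ha]
      gcongr
      rw [ENNReal.coe_inv (by positivity)]
      refine le_trans ?_ hn.le
      rw [ENNReal.inv_le_inv]
      push_cast
      exact le_self_add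
  rw [this]
  exact MeasurableSet.iInter fun n => h _ (by positivity)

theorem generateFrom_lowerBoxes (T : Type*) :
    MeasurableSpace.generateFrom (lowerBoxes T) = MeasurableSpace.pi := by
  refine le_antisymm (MeasurableSpace.generateFrom_le fun B hB =>
    measurableSet_of_mem_lowerBoxes hB) (iSup_le fun t => ?_)
  rw [← measurable_iff_comap_le]
  refine @measurable_of_Iic_pos _ (MeasurableSpace.generateFrom (lowerBoxes T)) _ fun c hc => ?_
  exact MeasurableSpace.measurableSet_generateFrom ⟨{t}, fun _ => c, fun _ => hc, by simp⟩

theorem ext_of_lowerBoxes {T : Type*} {m₁ m₂ : Measure (T → ℝ≥0∞)} [IsFiniteMeasure m₁]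
    (h : ∀ (I : Finset T) (c : T → ℝ≥0), (∀ t, 0 < c t) →
      m₁ {x | ∀ t ∈ I, x t ≤ c t} = m₂ {x | ∀ t ∈ I, x t ≤ c t}) : m₁ = m₂ := by
  refine ext_of_generate_finite (lowerBoxes T) (generateFrom_lowerBoxes T).symm
    (isPiSystem_lowerBoxes T) ?_ ?_
  · rintro _ ⟨I, c, hc, rfl⟩
    exact h I c hc
  · simpa using h ∅ (fun _ => 1) (by simp)

/-! ### Max-linear combinations and their tilted laws -/

/-- The max-linear combination `⋁ t ∈ I, a t • x t`. -/
def maxLin {T : Type*} (I : Finset T) (a : T → ℝ≥0) (x : T → ℝ≥0∞) : ℝ≥0∞ :=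
  I.sup fun t => (a t : ℝ≥0∞) * x t

section maxLin
variable {T : Type*} (I : Finset T) (a : T → ℝ≥0)

theorem measurable_maxLin : Measurable (maxLin I a) := by
  unfold maxLin
  simp only [Finset.sup_eq_iSup]
  exact Measurable.biSup _ I.countable_toSet fun t _ => (measurable_pi_apply t).const_mul _

theorem maxLin_lt_top {x : T → ℝ≥0∞} (hx : ∀ t, x t ≠ ∞) : maxLin I a x < ∞ :=
  (Finset.sup_lt_iff ENNReal.zero_lt_top).2 fun t _ =>
    ENNReal.mul_lt_top ENNReal.coe_lt_top (hx t).lt_top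

theorem maxLin_div (x : T → ℝ≥0∞) (u : ℝ≥0∞) :
    maxLin I a (fun t => x t / u) = maxLin I a x / u := by
  classical
  unfold maxLin
  simp only [div_eq_mul_inv, ← mul_assoc]
  induction I using Finset.induction_on with
  | empty => simp
  | insert t I _ ih => rw [Finset.sup_insert, Finset.sup_insert, ih]; exact (max_mul_mul_right _ _ _)

/-- Extending the coefficients by zero to `I ∪ J` allows a maximum coordinate by coordinate. This
closure under `⊔` puts the box masses below within reach of the known integrals. -/
theorem exists_maxLin_sup_eq (J : Finset T) (b : T → ℝ≥0) :
    ∃ (K : Finset T) (d : T → ℝ≥0), ∀ x, maxLin K d x = maxLin I a x ⊔ maxLin J b x := by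
  classical
  have key : ∀ (I K : Finset T) (a : T → ℝ≥0), I ⊆ K → ∀ x,
      maxLin I a x = maxLin K (fun t => if t ∈ I then a t else 0) x := by
    intro I K a hIK x
    refine le_antisymm (Finset.sup_le fun t ht => ?_) (Finset.sup_le fun t ht => ?_)
    · refine le_trans ?_ (Finset.le_sup (hIK ht))
      simp [ht]
    · by_cases h : t ∈ I
      · simp only [h, if_true]
        exact Finset.le_sup (f := fun t => (a t : ℝ≥0∞) * x t) h
      · simp [h]
  refine ⟨I ∪ J, fun t => (if t ∈ I then a t else 0) ⊔ (if t ∈ J then b t else 0), fun x => ?_⟩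
  rw [key I (I ∪ J) a Finset.subset_union_left, key J (I ∪ J) b Finset.subset_union_right]
  unfold maxLin
  rw [← Finset.sup_sup]
  refine Finset.sup_congr rfl fun t _ => ?_
  simp only [Pi.sup_apply, ENNReal.coe_max]
  exact (max_mul_mul_right _ _ _).symm

theorem lintegral_maxLin_lt_top {S : Type*} [MeasurableSpace S] {μ : Measure S}
    {y : T → S → ℝ≥0∞} (hy : ∀ t, Measurable (y t)) (hint : ∀ t, ∫⁻ s, y t s ∂μ < ∞) :
    ∫⁻ s, maxLin I a (fun t => y t s) ∂μ < ∞ := by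
  calc ∫⁻ s, maxLin I a (fun t => y t s) ∂μ ≤ ∫⁻ s, ∑ t ∈ I, (a t : ℝ≥0∞) * y t s ∂μ := by
        refine lintegral_mono fun s => Finset.sup_le fun t ht => ?_
        exact Finset.single_le_sum (f := fun t => (a t : ℝ≥0∞) * y t s) (fun _ _ => zero_le) ht
    _ = ∑ t ∈ I, (a t : ℝ≥0∞) * ∫⁻ s, y t s ∂μ := by
        rw [lintegral_finsetSum _ fun t _ => (hy t).const_mul _]
        exact Finset.sum_congr rfl fun t _ => lintegral_const_mul _ (hy t)
    _ < ∞ := ENNReal.sum_lt_top.2 fun t _ => ENNReal.mul_lt_top ENNReal.coe_lt_top (hint t)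

end maxLin

theorem volume_setOf_ofReal_lt_ofReal_ge {A B : ℝ≥0∞} (hA : A ≠ ∞) (hB : B ≠ ∞) :
    volume {u : ℝ | (0 < u ∧ ENNReal.ofReal u < A) ∧ B ≤ ENNReal.ofReal u} = A - B := by
  lift A to ℝ≥0 using hA
  lift B to ℝ≥0 using hB
  have h1 : {u : ℝ | (0 < u ∧ ENNReal.ofReal u < A) ∧ (B : ℝ≥0∞) ≤ ENNReal.ofReal u}
      = Ico (B : ℝ) A \ {0} := by
    ext u
    simp only [mem_ofPred_eq, mem_sdiff, mem_Ico, mem_singleton_iff]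
    constructor
    · rintro ⟨⟨h0, h1⟩, h2⟩
      rw [ENNReal.ofReal_lt_coe_iff h0.le] at h1
      rw [← ENNReal.ofReal_coe_nnreal, ENNReal.ofReal_le_ofReal_iff h0.le] at h2
      exact ⟨⟨h2, h1⟩, h0.ne'⟩
    · rintro ⟨⟨h2, h1⟩, h0⟩
      have h0' : 0 < u := lt_of_le_of_ne (B.2.trans h2) (Ne.symm h0)
      rw [ENNReal.ofReal_lt_coe_iff h0'.le, ← ENNReal.ofReal_coe_nnreal (p := B),
        ENNReal.ofReal_le_ofReal_iff h0'.le]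
      exact ⟨⟨h0', h1⟩, h2⟩
  rw [h1, measure_sdiff_null (by simp), Real.volume_Ico]
  rw [ENNReal.ofReal_sub (A : ℝ) B.coe_nonneg, ENNReal.ofReal_coe_nnreal, ENNReal.ofReal_coe_nnreal]

section Tilt
variable {T S : Type*} [MeasurableSpace S]

/-- The region `{(s, u) : 0 < u < F s}`. -/
def underGraph (F : S → ℝ≥0∞) : Set (S × ℝ) := {p | 0 < p.2 ∧ ENNReal.ofReal p.2 < F p.1}

theorem measurableSet_underGraph {F : S → ℝ≥0∞} (hF : Measurable F) :
    MeasurableSet (underGraph F) :=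
  (measurableSet_lt measurable_const measurable_snd).inter
    (measurableSet_lt (ENNReal.measurable_ofReal.comp measurable_snd) (hF.comp measurable_fst))

/-- The fibre over `s` has length `F s`, so forgetting `u` leaves the density `F`. -/
theorem map_fst_restrict_underGraph (μ : Measure S) [SFinite μ] {F : S → ℝ≥0∞}
    (hF : Measurable F) (hF' : ∀ s, F s ≠ ∞) :
    ((μ.prod volume).restrict (underGraph F)).map Prod.fst = μ.withDensity F := by
  ext V hV
  rw [Measure.map_apply measurable_fst hV, Measure.restrict_apply (measurable_fst hV),
    Measure.prod_apply ((measurable_fst hV).inter (measurableSet_underGraph hF)),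
    withDensity_apply _ hV, ← lintegral_indicator hV]
  refine lintegral_congr fun s => ?_
  by_cases hs : s ∈ V
  · rw [indicator_of_mem hs]
    refine Eq.trans ?_ ((volume_setOf_ofReal_lt_ofReal_ge (hF' s) ENNReal.zero_ne_top).trans
      (tsub_zero _))
    congr 1
    ext u
    simp [hs, underGraph]
  · rw [indicator_of_notMem hs]
    convert measure_empty (μ := (volume : Measure ℝ))
    ext u
    simp [hs]

/-- With `G = ⋁ y t / c t`, the box condition reads `G s ≤ u` and the region reads `u < F s`. The
fibre has length `(F - G)⁺ = F ⊔ G - G`, and both terms are max-linear. -/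
theorem restrict_underGraph_lowerBox (μ : Measure S) [SFinite μ] {y : T → S → ℝ≥0∞}
    (hy : ∀ t, Measurable (y t)) (hy' : ∀ t s, y t s ≠ ∞) (hint : ∀ t, ∫⁻ s, y t s ∂μ < ∞)
    (I : Finset T) (a : T → ℝ≥0) (J : Finset T) (c : T → ℝ≥0) (hc : ∀ t, 0 < c t) :
    (((μ.prod volume).restrict (underGraph fun s => maxLin I a fun t => y t s)).map
        fun p t => y t p.1 / ENNReal.ofReal p.2) {x | ∀ t ∈ J, x t ≤ c t}
      = ∫⁻ s, maxLin I a (fun t => y t s) ⊔ maxLin J (fun t => (c t)⁻¹) (fun t => y t s) ∂μ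
        - ∫⁻ s, maxLin J (fun t => (c t)⁻¹) (fun t => y t s) ∂μ := by
  have hF : ∀ (I : Finset T) (a : T → ℝ≥0), Measurable fun s => maxLin I a fun t => y t s :=
    fun I a => (measurable_maxLin I a).comp (measurable_pi_lambda _ hy)
  have hΦ : Measurable fun (p : S × ℝ) t => y t p.1 / ENNReal.ofReal p.2 :=
    measurable_pi_lambda _ fun t => ((hy t).comp measurable_fst).div
      (ENNReal.measurable_ofReal.comp measurable_snd)
  have hbox := measurableSet_of_mem_lowerBoxes (T := T) ⟨J, c, hc, rfl⟩
  rw [Measure.map_apply hΦ hbox, Measure.restrict_apply (hΦ hbox),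
    Measure.prod_apply ((hΦ hbox).inter (measurableSet_underGraph (hF I a))),
    ← lintegral_sub (hF _ _) (lintegral_maxLin_lt_top _ _ hy hint).ne]
  · refine lintegral_congr fun s => ?_
    have h1 : maxLin I a (fun t => y t s) ⊔ maxLin J (fun t => (c t)⁻¹) (fun t => y t s)
        - maxLin J (fun t => (c t)⁻¹) (fun t => y t s)
        = maxLin I a (fun t => y t s) - maxLin J (fun t => (c t)⁻¹) (fun t => y t s) := by
      rcases le_total (maxLin I a (fun t => y t s)) (maxLin J (fun t => (c t)⁻¹) (fun t => y t s))
        with h | h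
      · rw [sup_eq_right.2 h, tsub_self, tsub_eq_zero_of_le h]
      · rw [sup_eq_left.2 h]
    rw [h1, ← volume_setOf_ofReal_lt_ofReal_ge (maxLin_lt_top _ _ fun t => hy' t s).ne
      (maxLin_lt_top _ _ fun t => hy' t s).ne]
    congr 1
    ext u
    simp only [mem_preimage, mem_inter_iff, mem_ofPred_eq, underGraph]
    rw [and_comm]
    refine and_congr_right fun hu => ?_
    simp only [maxLin, Finset.sup_le_iff]
    refine forall₂_congr fun t _ => ?_
    have hu' : ENNReal.ofReal u ≠ 0 := by simpa using hu.1
    rw [ENNReal.div_le_iff hu' ENNReal.ofReal_ne_top, ENNReal.coe_inv (hc t).ne', mul_comm _ (y t s),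
      ← div_eq_mul_inv, ENNReal.div_le_iff (by simpa using (hc t).ne') ENNReal.coe_ne_top, mul_comm]
  · exact ae_of_all _ fun s => le_sup_right

/-- The law of `(y t / F) t` under the tilted measure `F • μ`, where `F = maxLin I a y`. -/
def tiltedLaw (μ : Measure S) (y : T → S → ℝ≥0∞) (I : Finset T) (a : T → ℝ≥0) :
    Measure (T → ℝ≥0∞) :=
  (μ.withDensity fun s => maxLin I a fun t => y t s).map
    fun s t => y t s / maxLin I a fun t => y t s

/-- `maxLin I a` is homogeneous of degree one, so normalising `y t / u` cancels `u`; the auxiliary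
variable survives only as the weight `F`. -/
theorem tiltedLaw_eq_map (μ : Measure S) [SFinite μ] {y : T → S → ℝ≥0∞}
    (hy : ∀ t, Measurable (y t)) (hy' : ∀ t s, y t s ≠ ∞) (I : Finset T) (a : T → ℝ≥0) :
    tiltedLaw μ y I a = (((μ.prod volume).restrict (underGraph fun s => maxLin I a fun t => y t s)).map
        fun p t => y t p.1 / ENNReal.ofReal p.2).map fun x t => x t / maxLin I a x := by
  have hF : Measurable fun s => maxLin I a fun t => y t s :=
    (measurable_maxLin I a).comp (measurable_pi_lambda _ hy)
  have hΦ : Measurable fun (p : S × ℝ) t => y t p.1 / ENNReal.ofReal p.2 :=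
    measurable_pi_lambda _ fun t => ((hy t).comp measurable_fst).div
      (ENNReal.measurable_ofReal.comp measurable_snd)
  rw [tiltedLaw, ← map_fst_restrict_underGraph μ hF fun s => (maxLin_lt_top _ _ fun t => hy' t s).ne,
    Measure.map_map (g := fun s t => y t s / maxLin I a fun t => y t s)
      (measurable_pi_lambda _ fun t => (hy t).div hF) measurable_fst,
    Measure.map_map (g := fun x t => x t / maxLin I a x) (measurable_pi_lambda _ fun t =>
      (measurable_pi_apply t).div (measurable_maxLin I a)) hΦ]
  refine Measure.map_congr ?_
  filter_upwards [ae_restrict_mem (measurableSet_underGraph hF)] with p hp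
  funext t
  have hp0 : ENNReal.ofReal p.2 ≠ 0 := by simpa using hp.1
  simp only [Function.comp_apply, maxLin_div]
  simp only [div_eq_mul_inv]
  exact (ENNReal.mul_div_mul_right _ _ (ENNReal.inv_ne_zero.2 ENNReal.ofReal_ne_top)
    (ENNReal.inv_ne_top.2 hp0)).symm

end Tilt

/-- The tilted laws only depend on the integrals of the max-linear combinations. -/
theorem tiltedLaw_congr {T S₁ S₂ : Type*} [MeasurableSpace S₁] [MeasurableSpace S₂]
    {μ₁ : Measure S₁} {μ₂ : Measure S₂} [SFinite μ₁] [SFinite μ₂]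
    {y₁ : T → S₁ → ℝ≥0∞} {y₂ : T → S₂ → ℝ≥0∞}
    (hy₁ : ∀ t, Measurable (y₁ t)) (hy₁' : ∀ t s, y₁ t s ≠ ∞) (hint₁ : ∀ t, ∫⁻ s, y₁ t s ∂μ₁ < ∞)
    (hy₂ : ∀ t, Measurable (y₂ t)) (hy₂' : ∀ t s, y₂ t s ≠ ∞) (hint₂ : ∀ t, ∫⁻ s, y₂ t s ∂μ₂ < ∞)
    (h : ∀ (I : Finset T) (a : T → ℝ≥0), ∫⁻ s, maxLin I a (fun t => y₁ t s) ∂μ₁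
      = ∫⁻ s, maxLin I a (fun t => y₂ t s) ∂μ₂) (I : Finset T) (a : T → ℝ≥0) :
    tiltedLaw μ₁ y₁ I a = tiltedLaw μ₂ y₂ I a := by
  rw [tiltedLaw_eq_map μ₁ hy₁ hy₁', tiltedLaw_eq_map μ₂ hy₂ hy₂']
  congr 1
  -- Uniqueness on the `π`-system of boxes needs a finite measure; the total mass here is `∫ F dμ₁`.
  have : IsFiniteMeasure ((μ₁.prod volume).restrict
      (underGraph fun s => maxLin I a fun t => y₁ t s)) := by
    have hF : Measurable fun s => maxLin I a fun t => y₁ t s :=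
      (measurable_maxLin I a).comp (measurable_pi_lambda _ hy₁)
    have h1 := congrArg (fun m => m univ)
      (map_fst_restrict_underGraph μ₁ hF fun s => (maxLin_lt_top _ _ fun t => hy₁' t s).ne)
    simp only [Measure.map_apply measurable_fst MeasurableSet.univ, preimage_univ,
      withDensity_apply _ MeasurableSet.univ, setLIntegral_univ] at h1
    exact ⟨h1 ▸ lintegral_maxLin_lt_top _ _ hy₁ hint₁⟩
  refine ext_of_lowerBoxes fun J c hc => ?_
  rw [restrict_underGraph_lowerBox μ₁ hy₁ hy₁' hint₁ I a J c hc,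
    restrict_underGraph_lowerBox μ₂ hy₂ hy₂' hint₂ I a J c hc, h J]
  obtain ⟨K, d, hK⟩ := exists_maxLin_sup_eq I a J (fun t => (c t)⁻¹)
  simp only [← hK, h]

/-! ### Coordinates of the random class `g · s` in `L⁰(lam)` -/

section GraphCoord
variable {T S : Type*} [MeasurableSpace T] [MeasurableSpace S]

/-- The masses that the image of `lam` on the graph of `g · s` gives to the sets `W k`. -/
def graphCoord (lam : Measure T) [IsZeroOrProbabilityMeasure lam] (W : ℕ → Set (T × ℝ≥0∞))
    (g : T → S → ℝ≥0∞) (s : S) (k : ℕ) : unitInterval :=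
  ⟨lam.real {t | (t, g t s) ∈ W k}, measureReal_nonneg, measureReal_le_one⟩

variable {lam : Measure T} [IsZeroOrProbabilityMeasure lam] {W : ℕ → Set (T × ℝ≥0∞)}
  {g : T → S → ℝ≥0∞}

theorem measurable_graphCoord (hW : ∀ k, MeasurableSet (W k))
    (hg : Measurable (Function.uncurry g)) : Measurable (graphCoord lam W g) := by
  refine measurable_pi_lambda _ fun k => Measurable.subtype_mk ?_
  have hE : MeasurableSet {p : S × T | (p.2, g p.2 p.1) ∈ W k} :=
    (measurable_snd.prodMk (hg.comp measurable_swap)) (hW k)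
  exact (measurable_measure_prodMk_left hE).ennreal_toReal

/-- A product of `lam`-masses is the mass of a box under a power of `lam`. Exchanging the integrals
fixes the points `τ i` first, and what remains is a finite-dimensional event for `g`. -/
theorem integral_prod_graphCoord (hW : ∀ k, MeasurableSet (W k))
    (hg : Measurable (Function.uncurry g)) (m : Measure S) [IsFiniteMeasure m] (l : List ℕ) :
    ∫ s, (l.map fun k => (graphCoord lam W g s k : ℝ)).prod ∂m
      = (∫⁻ τ, (m.map fun s t => g t s) {x | ∀ i : Fin l.length, (τ i, x (τ i)) ∈ W (l[i.1])}
          ∂Measure.pi fun _ : Fin l.length => lam).toReal := by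
  have hlaw : Measurable fun s t => g t s :=
    measurable_pi_lambda _ fun t => hg.comp measurable_prodMk_left
  have hset : ∀ τ : Fin l.length → T,
      MeasurableSet {x : T → ℝ≥0∞ | ∀ i : Fin l.length, (τ i, x (τ i)) ∈ W (l[i.1])} := by
    intro τ
    simp only [ofPred_forall]
    exact MeasurableSet.iInter fun i =>
      (measurable_const.prodMk (measurable_pi_apply (τ i))) (hW _)
  let E : Set (S × (Fin l.length → T)) :=
    {p | ∀ i : Fin l.length, (p.2 i, g (p.2 i) p.1) ∈ W (l[i.1])}
  have hE : MeasurableSet E := by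
    simp only [E, ofPred_forall]
    refine MeasurableSet.iInter fun i => ?_
    have h1 : Measurable fun p : S × (Fin l.length → T) => p.2 i :=
      (measurable_pi_apply i).comp measurable_snd
    exact (h1.prodMk (hg.comp (h1.prodMk measurable_fst))) (hW _)
  have h1 : ∀ s, (l.map fun k => (graphCoord lam W g s k : ℝ)).prod
      = ((Measure.pi fun _ : Fin l.length => lam) (Prod.mk s ⁻¹' E)).toReal := by
    intro s
    have : Prod.mk s ⁻¹' E = univ.pi fun i : Fin l.length => {t | (t, g t s) ∈ W (l[i.1])} := by
      ext τ; simp [E]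
    rw [this, Measure.pi_pi, ENNReal.toReal_prod, ← Fin.prod_univ_fun_getElem]
    rfl
  simp only [h1]
  rw [integral_toReal (measurable_measure_prodMk_left hE).aemeasurable
    (ae_of_all _ fun s => measure_lt_top _ _), ← Measure.prod_apply hE, Measure.prod_apply_symm hE]
  congr 1
  refine lintegral_congr fun τ => ?_
  rw [Measure.map_apply hlaw (hset τ)]
  rfl

/-- The law of the coordinates only depends on the finite-dimensional laws of `g`. -/
theorem map_graphCoord_congr {S' : Type*} [MeasurableSpace S'] {g' : T → S' → ℝ≥0∞}
    (hW : ∀ k, MeasurableSet (W k)) (hg : Measurable (Function.uncurry g))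
    (hg' : Measurable (Function.uncurry g')) {m : Measure S} [IsFiniteMeasure m] {m' : Measure S'}
    [IsFiniteMeasure m'] (h : (m.map fun s t => g t s) = m'.map fun s t => g' t s) :
    m.map (graphCoord lam W g) = m'.map (graphCoord lam W g') := by
  have hmeas : ∀ l : List ℕ, Measurable fun x : ℕ → unitInterval => (l.map fun k => (x k : ℝ)).prod := by
    intro l
    induction l with
    | nil => simp
    | cons a l ih =>
      simp only [List.map_cons, List.prod_cons]
      exact (measurable_subtype_coe.comp (measurable_pi_apply a)).mul ih
  refine ext_of_moments fun l => ?_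
  rw [integral_map (measurable_graphCoord hW hg).aemeasurable (hmeas l).aestronglyMeasurable,
    integral_map (measurable_graphCoord hW hg').aemeasurable (hmeas l).aestronglyMeasurable,
    integral_prod_graphCoord hW hg, integral_prod_graphCoord hW hg', h]

/-- Equal coordinates make the images of `lam` on the two graphs agree on a generating `π`-system,
hence everywhere. One image is carried by the graph of `g · s`, so the other is too. -/
theorem ae_eq_of_graphCoord_eq {S' : Type*} [MeasurableSpace S'] {g' : T → S' → ℝ≥0∞}
    (hW : IsPiSystem (range W)) (hgen : MeasurableSpace.generateFrom (range W) = Prod.instMeasurableSpace)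
    (hg : Measurable (Function.uncurry g))
    (hg' : Measurable (Function.uncurry g')) {s : S} {s' : S'}
    (h : graphCoord lam W g s = graphCoord lam W g' s') :
    (fun t => g t s) =ᵐ[lam] fun t => g' t s' := by
  have hWm : ∀ k, MeasurableSet (W k) := fun k => by
    rw [← hgen]; exact MeasurableSpace.measurableSet_generateFrom ⟨k, rfl⟩
  have h1 : Measurable fun t => (t, g t s) :=
    measurable_id.prodMk (hg.comp measurable_prodMk_right)
  have h2 : Measurable fun t => (t, g' t s') :=
    measurable_id.prodMk (hg'.comp measurable_prodMk_right)
  have hmap : lam.map (fun t => (t, g t s)) = lam.map fun t => (t, g' t s') := by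
    refine ext_of_generate_finite (range W) hgen.symm hW ?_ ?_
    · rintro _ ⟨k, rfl⟩
      rw [Measure.map_apply h1 (hWm k), Measure.map_apply h2 (hWm k)]
      have := congrArg Subtype.val (congrFun h k)
      exact (ENNReal.toReal_eq_toReal_iff' (measure_ne_top _ _) (measure_ne_top _ _)).1 this
    · rw [Measure.map_apply h1 MeasurableSet.univ, Measure.map_apply h2 MeasurableSet.univ]
      rfl
  have hD : MeasurableSet {p : T × ℝ≥0∞ | p.2 ≠ g p.1 s} :=
    (measurableSet_eq_fun measurable_snd
      ((hg.comp measurable_prodMk_right).comp measurable_fst)).compl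
  have h3 := congrArg (fun m => m {p : T × ℝ≥0∞ | p.2 ≠ g p.1 s}) hmap
  simp only [Measure.map_apply h1 hD, Measure.map_apply h2 hD] at h3
  simp only [preimage_ofPred_eq, ne_eq, not_true_eq_false] at h3
  rw [Filter.EventuallyEq, ae_iff]
  simp only [eq_comm (a := g _ s)]
  rw [← h3]
  simp

end GraphCoord

/-! ### Transfer of sets between two representations -/

/-- `x'` is `lam`-almost everywhere a positive multiple of `x`. -/
def Proportional {T : Type*} [MeasurableSpace T] (lam : Measure T) (x x' : T → ℝ≥0∞) : Prop :=
  ∃ c : ℝ≥0, c ≠ 0 ∧ x' =ᵐ[lam] fun t => c * x t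

/-- The measure `μ` with density `maxLin I a y`. -/
def tilted {T S : Type*} [MeasurableSpace S] (μ : Measure S) (y : T → S → ℝ≥0∞) (I : Finset T)
    (a : T → ℝ≥0) : Measure S :=
  μ.withDensity fun s => maxLin I a fun t => y t s

theorem tilted_absolutelyContinuous {T S : Type*} [MeasurableSpace S] {μ : Measure S}
    {y : T → S → ℝ≥0∞} {I : Finset T} {a : T → ℝ≥0} : tilted μ y I a ≪ μ :=
  withDensity_absolutelyContinuous _ _

/-- `y` is a jointly measurable family of finite `μ`-integrable functions. -/
structure IsSpectralFamily {T S : Type*} [MeasurableSpace T] [MeasurableSpace S] (μ : Measure S)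
    (y : T → S → ℝ≥0∞) : Prop where
  measurable : Measurable (Function.uncurry y)
  ne_top : ∀ t s, y t s ≠ ∞
  integrable : ∀ t, ∫⁻ s, y t s ∂μ < ∞

namespace IsSpectralFamily
variable {T S : Type*} [MeasurableSpace T] [MeasurableSpace S] {μ : Measure S} {y : T → S → ℝ≥0∞}

theorem measurable_right (h : IsSpectralFamily μ y) (t : T) : Measurable (y t) :=
  h.measurable.comp measurable_prodMk_left

theorem measurable_maxLin (h : IsSpectralFamily μ y) (I : Finset T) (a : T → ℝ≥0) :
    Measurable fun s => maxLin I a fun t => y t s :=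
  (FrechetProcess.measurable_maxLin I a).comp (measurable_pi_lambda _ h.measurable_right)

theorem isFiniteMeasure_tilted (h : IsSpectralFamily μ y) (I : Finset T) (a : T → ℝ≥0) :
    IsFiniteMeasure (tilted μ y I a) :=
  isFiniteMeasure_withDensity (lintegral_maxLin_lt_top I a h.measurable_right h.integrable).ne

theorem tilted_setOf_maxLin_eq_zero (h : IsSpectralFamily μ y) (I : Finset T) (a : T → ℝ≥0) :
    tilted μ y I a {s | maxLin I a (fun t => y t s) = 0} = 0 := by
  have hm : MeasurableSet {s | maxLin I a (fun t => y t s) = 0} :=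
    h.measurable_maxLin I a (measurableSet_singleton 0)
  rw [tilted, withDensity_apply _ hm]
  exact setLIntegral_eq_zero hm fun s hs => hs

end IsSpectralFamily

/-- Two spectral families with the same integrals of max-linear combinations: every Borel set for
the first one has a counterpart for the second one. -/
theorem exists_transfer {T S₁ S₂ ι : Type*} [MeasurableSpace T] [MeasurableSpace.CountablyGenerated T]
    (lam : Measure T) [SigmaFinite lam] [MeasurableSpace S₁] [StandardBorelSpace S₁]
    [MeasurableSpace S₂] [Countable ι] {μ₁ : Measure S₁} {μ₂ : Measure S₂} [SFinite μ₁] [SFinite μ₂]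
    {y₁ : T → S₁ → ℝ≥0∞} {y₂ : T → S₂ → ℝ≥0∞} (h₁ : IsSpectralFamily μ₁ y₁)
    (h₂ : IsSpectralFamily μ₂ y₂)
    (h : ∀ (I : Finset T) (a : T → ℝ≥0), ∫⁻ s, maxLin I a (fun t => y₁ t s) ∂μ₁
      = ∫⁻ s, maxLin I a (fun t => y₂ t s) ∂μ₂) (I : Finset T) (a : T → ℝ≥0)
    (A : ι → Set S₁) (hA : ∀ j, MeasurableSet (A j)) :
    ∃ B : ι → Set S₂, (∀ j, MeasurableSet (B j)) ∧
      (∀ j, ∀ s' ∈ B j, ∃ s ∈ A j, Proportional lam (fun t => y₁ t s) fun t => y₂ t s') ∧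
      (∀ j, tilted μ₁ y₁ I a (A j) ≤ tilted μ₂ y₂ I a (B j)) ∧
      tilted μ₁ y₁ I a (⋃ j, A j) ≤ tilted μ₂ y₂ I a (⋃ j, B j) := by
  obtain ⟨W, hW, hgen⟩ := exists_seq_piSystem (T × ℝ≥0∞)
  have hWm : ∀ k, MeasurableSet (W k) := fun k => by
    rw [hgen]; exact MeasurableSpace.measurableSet_generateFrom ⟨k, rfl⟩
  -- `lam` is traded for a finite measure with the same null sets, which leaves the classes modulo
  -- null functions unchanged and puts the coordinates in `[0, 1]`.
  have : IsZeroOrProbabilityMeasure lam.toFinite := by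
    unfold Measure.toFinite; infer_instance
  let F₁ : S₁ → ℝ≥0∞ := fun s => maxLin I a fun t => y₁ t s
  let F₂ : S₂ → ℝ≥0∞ := fun s => maxLin I a fun t => y₂ t s
  have hF₁ : Measurable F₁ := h₁.measurable_maxLin I a
  have hF₂ : Measurable F₂ := h₂.measurable_maxLin I a
  let g₁ : T → S₁ → ℝ≥0∞ := fun t s => y₁ t s / F₁ s
  let g₂ : T → S₂ → ℝ≥0∞ := fun t s => y₂ t s / F₂ s
  have hg₁ : Measurable (Function.uncurry g₁) := h₁.measurable.div (hF₁.comp measurable_snd)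
  have hg₂ : Measurable (Function.uncurry g₂) := h₂.measurable.div (hF₂.comp measurable_snd)
  have hfin₁ := h₁.isFiniteMeasure_tilted I a
  have hfin₂ := h₂.isFiniteMeasure_tilted I a
  have hlaw : (tilted μ₁ y₁ I a).map (graphCoord lam.toFinite W g₁)
      = (tilted μ₂ y₂ I a).map (graphCoord lam.toFinite W g₂) :=
    map_graphCoord_congr hWm hg₁ hg₂ (tiltedLaw_congr h₁.measurable_right h₁.ne_top h₁.integrable
      h₂.measurable_right h₂.ne_top h₂.integrable h I a)
  have hJ₁ := measurable_graphCoord (lam := lam.toFinite) hWm hg₁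
  have hJ₂ := measurable_graphCoord (lam := lam.toFinite) hWm hg₂
  have hZ₁ : MeasurableSet {s | F₁ s = 0} := hF₁ (measurableSet_singleton 0)
  have hZ₂ : MeasurableSet {s | F₂ s = 0} := hF₂ (measurableSet_singleton 0)
  -- The image of `A j` need not be Borel, so a Borel subset carrying all its mass is used. The
  -- zeros of `F₁`, where normalisation is meaningless, are `tilted`-null and are discarded.
  choose B hBsub hBm hB0 using fun j =>
    exists_measurableSet_subset_image (tilted μ₁ y₁ I a) hJ₁ ((hA j).diff hZ₁)
  have hnull : ∀ j, tilted μ₁ y₁ I a (A j \ graphCoord lam.toFinite W g₁ ⁻¹' B j) = 0 := by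
    intro j
    refine measure_mono_null (t := (A j \ {s | F₁ s = 0}) \ graphCoord lam.toFinite W g₁ ⁻¹' B j
      ∪ {s | F₁ s = 0}) ?_ (measure_union_null (hB0 j) (h₁.tilted_setOf_maxLin_eq_zero I a))
    rintro s ⟨hs, hs'⟩
    by_cases hz : F₁ s = 0
    · exact Or.inr hz
    · exact Or.inl ⟨⟨hs, hz⟩, hs'⟩
  have hmass : ∀ C : Set (ℕ → unitInterval), MeasurableSet C →
      tilted μ₁ y₁ I a (graphCoord lam.toFinite W g₁ ⁻¹' C)
        = tilted μ₂ y₂ I a (graphCoord lam.toFinite W g₂ ⁻¹' C \ {s | F₂ s = 0}) := by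
    intro C hC
    rw [measure_sdiff_null (h₂.tilted_setOf_maxLin_eq_zero I a), ← Measure.map_apply hJ₁ hC,
      ← Measure.map_apply hJ₂ hC, hlaw]
  refine ⟨fun j => graphCoord lam.toFinite W g₂ ⁻¹' B j \ {s | F₂ s = 0},
    fun j => (hJ₂ (hBm j)).diff hZ₂, ?_, fun j => ?_, ?_⟩
  · rintro j s' ⟨hs', hs0⟩
    obtain ⟨s, ⟨hsA, hs0'⟩, hss'⟩ := hBsub j hs'
    refine ⟨s, hsA, ?_⟩
    have hae := ae_eq_of_graphCoord_eq hW hgen.symm hg₁ hg₂ hss'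
    rw [Filter.EventuallyEq, ae_toFinite] at hae
    have ht₁ : F₁ s ≠ ∞ := (maxLin_lt_top _ _ fun t => h₁.ne_top t s).ne
    have ht₂ : F₂ s' ≠ ∞ := (maxLin_lt_top _ _ fun t => h₂.ne_top t s').ne
    have hs0 : F₂ s' ≠ 0 := hs0
    have hs0' : F₁ s ≠ 0 := hs0'
    -- The normalised functions agree almost everywhere, so the unnormalised ones differ by the
    -- ratio of the normalisers.
    refine ⟨(F₂ s' / F₁ s).toNNReal, ?_, ?_⟩
    · rw [Ne, ENNReal.toNNReal_eq_zero_iff]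
      simp [ENNReal.div_eq_zero_iff, ENNReal.div_eq_top, hs0, hs0', ht₁, ht₂]
    · filter_upwards [hae] with t ht
      have ht : y₁ t s / F₁ s = y₂ t s' / F₂ s' := ht
      rw [ENNReal.coe_toNNReal (ENNReal.div_ne_top ht₂ hs0')]
      calc y₂ t s' = F₂ s' * (y₂ t s' / F₂ s') := (ENNReal.mul_div_cancel hs0 ht₂).symm
        _ = F₂ s' * (y₁ t s / F₁ s) := by rw [ht]
        _ = F₂ s' / F₁ s * y₁ t s := by simp only [div_eq_mul_inv]; ring
  · rw [← hmass _ (hBm j)]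
    exact measure_mono_ae (by
      rw [ae_le_set]
      exact hnull j)
  -- The pieces may overlap, so the bound for the union does not follow from the bounds for the
  -- pieces.
  · have hU : (⋃ j, graphCoord lam.toFinite W g₂ ⁻¹' B j \ {s | F₂ s = 0})
        = graphCoord lam.toFinite W g₂ ⁻¹' (⋃ j, B j) \ {s | F₂ s = 0} := by
      rw [preimage_iUnion, iUnion_sdiff]
    rw [hU, ← hmass _ (MeasurableSet.iUnion hBm)]
    refine measure_mono_ae ?_
    rw [ae_le_set, preimage_iUnion, iUnion_sdiff, measure_iUnion_null_iff]
    exact fun j => measure_mono_null (sdiff_subset_sdiff_right (subset_iUnion _ j)) (hnull j)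

theorem tilted_univ {T S : Type*} [MeasurableSpace S] (μ : Measure S) (y : T → S → ℝ≥0∞)
    (I : Finset T) (a : T → ℝ≥0) :
    tilted μ y I a univ = ∫⁻ s, maxLin I a (fun t => y t s) ∂μ := by
  rw [tilted, withDensity_apply _ MeasurableSet.univ, setLIntegral_univ]

/-- The joint support of a spectral family is carried by countably many of its members. -/
theorem exists_countable_support {T S : Type*} [MeasurableSpace T] [MeasurableSpace S]
    {μ : Measure S} [SFinite μ] {y : T → S → ℝ≥0∞} (h : IsSpectralFamily μ y) :
    ∃ D : Set T, D.Countable ∧ ∀ t, ∀ᵐ s ∂μ, (∀ d ∈ D, y d s = 0) → y t s = 0 := by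
  let U : Set T → Set S := fun D => ⋃ d ∈ D, {s | y d s ≠ 0}
  have hne : ∀ t, MeasurableSet {s | y t s ≠ 0} := fun t =>
    h.measurable_right t (measurableSet_singleton 0).compl
  have hU : ∀ D : Set T, D.Countable → MeasurableSet (U D) := fun D hD =>
    MeasurableSet.biUnion hD fun t _ => hne t
  -- Exhaustion: countable unions make the supremum of the masses of countable supports attained,
  -- and one more index cannot increase it.
  let R : Set ℝ≥0∞ := (fun D => μ.toFinite (U D)) '' {D : Set T | D.Countable}
  obtain ⟨u, -, hu, huR⟩ := exists_seq_tendsto_sSup (S := R)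
    ⟨_, mem_image_of_mem _ countable_empty⟩ (OrderTop.bddAbove _)
  choose D hD hDu using huR
  have hDc : (⋃ n, D n).Countable := countable_iUnion hD
  refine ⟨⋃ n, D n, hDc, fun t => ?_⟩
  have hmax : sSup R ≤ μ.toFinite (U (⋃ n, D n)) := by
    refine le_of_tendsto' hu fun n => ?_
    rw [← hDu n]
    exact measure_mono (biUnion_subset_biUnion_left (subset_iUnion D n))
  have hle : μ.toFinite (U (insert t (⋃ n, D n))) ≤ μ.toFinite (U (⋃ n, D n)) :=
    le_trans (le_sSup (show μ.toFinite (U (insert t (⋃ n, D n))) ∈ R from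
      ⟨_, hDc.insert t, rfl⟩)) hmax
  have hsub : U (⋃ n, D n) ⊆ U (insert t (⋃ n, D n)) :=
    biUnion_subset_biUnion_left (subset_insert _ _)
  have h0 : μ.toFinite (U (insert t (⋃ n, D n)) \ U (⋃ n, D n)) = 0 := by
    rw [measure_sdiff hsub (hU _ hDc).nullMeasurableSet (measure_ne_top _ _),
      tsub_eq_zero_of_le hle]
  rw [toFinite_apply_eq_zero_iff] at h0
  filter_upwards [measure_eq_zero_iff_ae_notMem.1 h0] with s hs hz
  by_contra hne'
  refine hs ⟨mem_iUnion₂.2 ⟨t, mem_insert _ _, hne'⟩, fun hmem => ?_⟩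
  obtain ⟨d, hd, hds⟩ := mem_iUnion₂.1 hmem
  exact hds (hz d hd)

section Compare
variable {T S₁ S₂ ι : Type*}
  [MeasurableSpace T] [MeasurableSpace.CountablyGenerated T]
  {lam : Measure T} [SigmaFinite lam] [MeasurableSpace S₁]
  [MeasurableSpace S₂] {μ₁ : Measure S₁} {μ₂ : Measure S₂}
  [SFinite μ₁] [SFinite μ₂] {y₁ : T → S₁ → ℝ≥0∞} {y₂ : T → S₂ → ℝ≥0∞}

/-- The points proportional to a point of `A` may form a non-measurable set, so the hypothesis on
`A'` is an implication; the transferred Borel set lies in `A'` up to a null set. -/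
theorem tilted_le_of_proportional [StandardBorelSpace S₁] (h₁ : IsSpectralFamily μ₁ y₁) (h₂ : IsSpectralFamily μ₂ y₂)
    (h : ∀ (I : Finset T) (a : T → ℝ≥0), ∫⁻ s, maxLin I a (fun t => y₁ t s) ∂μ₁
      = ∫⁻ s, maxLin I a (fun t => y₂ t s) ∂μ₂) (I : Finset T) (a : T → ℝ≥0)
    {A : Set S₁} (hA : MeasurableSet A) {A' : Set S₂}
    (hA' : ∀ᵐ s' ∂tilted μ₂ y₂ I a,
      (∃ s ∈ A, Proportional lam (fun t => y₁ t s) fun t => y₂ t s') → s' ∈ A') :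
    tilted μ₁ y₁ I a A ≤ tilted μ₂ y₂ I a A' := by
  obtain ⟨B, -, hB, hle, -⟩ :=
    exists_transfer lam h₁ h₂ h I a (fun _ : Unit => A) fun _ => hA
  refine (hle ()).trans (measure_mono_ae ?_)
  filter_upwards [hA'] with s' hs' hs
  exact hs' (hB () s' hs)

/-- If the first family has no trivial co-spectral functions, neither has the second one. -/
theorem ae_tilted_ne_zero [StandardBorelSpace S₂] (h₁ : IsSpectralFamily μ₁ y₁)
    (h₂ : IsSpectralFamily μ₂ y₂)
    (h : ∀ (I : Finset T) (a : T → ℝ≥0), ∫⁻ s, maxLin I a (fun t => y₁ t s) ∂μ₁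
      = ∫⁻ s, maxLin I a (fun t => y₂ t s) ∂μ₂) (I : Finset T) (a : T → ℝ≥0)
    (h0 : ∀ᵐ s ∂μ₁, ¬ (fun t => y₁ t s) =ᵐ[lam] 0) :
    ∀ᵐ s ∂tilted μ₂ y₂ I a, ¬ (fun t => y₂ t s) =ᵐ[lam] 0 := by
  have hZ : MeasurableSet {s | (fun t => y₂ t s) =ᵐ[lam] 0} := by
    have : {s | (fun t => y₂ t s) =ᵐ[lam] 0} = {s | ∫⁻ t, y₂ t s ∂lam = 0} := by
      ext s
      exact (lintegral_eq_zero_iff (h₂.measurable.comp measurable_prodMk_right)).symm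
    rw [this]
    exact (h₂.measurable.lintegral_prod_left') (measurableSet_singleton 0)
  -- A point of `S₁` proportional to a trivial one is itself trivial, which `h0` excludes almost
  -- everywhere; so the empty set serves as target.
  have key := tilted_le_of_proportional (lam := lam) h₂ h₁ (fun I a => (h I a).symm) I a hZ
    (A' := ∅) (by
      filter_upwards [tilted_absolutelyContinuous.ae_le h0] with s hs
      rintro ⟨s', hs', c, -, hc⟩
      have hs' : (fun t => y₂ t s') =ᵐ[lam] 0 := hs'
      refine (hs ?_).elim
      filter_upwards [hc, hs'] with t ht ht'
      rw [ht, ht', Pi.zero_apply, mul_zero])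
  rw [ae_iff]
  simpa using key

/-- A point of `S₂` proportional to a point of `A₁ j` inherits `Q j`; since the `A₂ k` cover and the
`Q k` exclude one another, it lies in `A₂ j`. This gives one inequality, and symmetry gives the
other. -/
theorem tilted_eq_of_proportional [Countable ι] [StandardBorelSpace S₁] [StandardBorelSpace S₂] (h₁ : IsSpectralFamily μ₁ y₁)
    (h₂ : IsSpectralFamily μ₂ y₂)
    (h : ∀ (I : Finset T) (a : T → ℝ≥0), ∫⁻ s, maxLin I a (fun t => y₁ t s) ∂μ₁
      = ∫⁻ s, maxLin I a (fun t => y₂ t s) ∂μ₂) (I : Finset T) (a : T → ℝ≥0)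
    (Q : ι → (T → ℝ≥0∞) → Prop) (hQ : ∀ j x x', Proportional lam x x' → Q j x → Q j x')
    {A₁ : ι → Set S₁} (hA₁ : ∀ j, MeasurableSet (A₁ j)) (hc₁ : μ₁ (⋃ j, A₁ j)ᶜ = 0)
    (hQ₁ : ∀ j, ∀ s ∈ A₁ j, Q j fun t => y₁ t s)
    (hd₁ : ∀ j k, j ≠ k → ∀ᵐ s ∂tilted μ₁ y₁ I a, ¬ (Q j (fun t => y₁ t s) ∧ Q k fun t => y₁ t s))
    {A₂ : ι → Set S₂} (hA₂ : ∀ j, MeasurableSet (A₂ j)) (hc₂ : μ₂ (⋃ j, A₂ j)ᶜ = 0)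
    (hQ₂ : ∀ j, ∀ s ∈ A₂ j, Q j fun t => y₂ t s)
    (hd₂ : ∀ j k, j ≠ k → ∀ᵐ s ∂tilted μ₂ y₂ I a, ¬ (Q j (fun t => y₂ t s) ∧ Q k fun t => y₂ t s))
    (j : ι) : tilted μ₁ y₁ I a (A₁ j) = tilted μ₂ y₂ I a (A₂ j) := by
  refine le_antisymm (tilted_le_of_proportional (lam := lam) h₁ h₂ h I a (hA₁ j) ?_)
    (tilted_le_of_proportional (lam := lam) h₂ h₁ (fun I a => (h I a).symm) I a (hA₂ j) ?_)
  · have h1 : ∀ᵐ s ∂tilted μ₂ y₂ I a, s ∈ ⋃ j, A₂ j := tilted_absolutelyContinuous hc₂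
    have h2 : ∀ᵐ s ∂tilted μ₂ y₂ I a, ∀ k, j ≠ k →
        ¬ (Q j (fun t => y₂ t s) ∧ Q k fun t => y₂ t s) := by
      rw [ae_all_iff]
      exact fun k => Filter.eventually_imp_distrib_left.2 (hd₂ j k)
    filter_upwards [h1, h2] with s' hs' hd
    rintro ⟨s, hs, hp⟩
    obtain ⟨k, hk⟩ := mem_iUnion.1 hs'
    by_cases hjk : j = k
    · exact hjk ▸ hk
    · exact (hd k hjk ⟨hQ j _ _ hp (hQ₁ j s hs), hQ₂ k s' hk⟩).elim
  · have h1 : ∀ᵐ s ∂tilted μ₁ y₁ I a, s ∈ ⋃ j, A₁ j := tilted_absolutelyContinuous hc₁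
    have h2 : ∀ᵐ s ∂tilted μ₁ y₁ I a, ∀ k, j ≠ k →
        ¬ (Q j (fun t => y₁ t s) ∧ Q k fun t => y₁ t s) := by
      rw [ae_all_iff]
      exact fun k => Filter.eventually_imp_distrib_left.2 (hd₁ j k)
    filter_upwards [h1, h2] with s' hs' hd
    rintro ⟨s, hs, hp⟩
    obtain ⟨k, hk⟩ := mem_iUnion.1 hs'
    by_cases hjk : j = k
    · exact hjk ▸ hk
    · exact (hd k hjk ⟨hQ j _ _ hp (hQ₂ j s hs), hQ₁ k s' hk⟩).elim

/-- The sets of a cover for the first family can be transferred to sets for the second family that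
cover everything except points where the second family vanishes. -/
theorem exists_transfer_cover [Countable ι] [StandardBorelSpace S₁] (h₁ : IsSpectralFamily μ₁ y₁)
    (h₂ : IsSpectralFamily μ₂ y₂)
    (h : ∀ (I : Finset T) (a : T → ℝ≥0), ∫⁻ s, maxLin I a (fun t => y₁ t s) ∂μ₁
      = ∫⁻ s, maxLin I a (fun t => y₂ t s) ∂μ₂)
    {A : ι → Set S₁} (hA : ∀ j, MeasurableSet (A j)) (hc : μ₁ (⋃ j, A j)ᶜ = 0) :
    ∃ B : ι → Set S₂, (∀ j, MeasurableSet (B j)) ∧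
      (∀ j, ∀ s' ∈ B j, ∃ s ∈ A j, Proportional lam (fun t => y₁ t s) fun t => y₂ t s') ∧
      ∀ t, ∀ᵐ s' ∂μ₂, s' ∉ ⋃ j, B j → y₂ t s' = 0 := by
  obtain ⟨D, hD, hsupp⟩ := exists_countable_support h₂
  -- The single index `d` with weight `1` tilts by `y d`, so the transfer sees exactly the points
  -- where `y₂ d` does not vanish. Countably many `d` exhaust the joint support.
  choose B hBm hB _ hle using fun d : T =>
    exists_transfer lam h₁ h₂ h {d} (fun _ => 1) A hA
  have key : ∀ d, ∀ᵐ s' ∂μ₂, s' ∉ ⋃ j, B d j → y₂ d s' = 0 := by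
    intro d
    have hfin := h₂.isFiniteMeasure_tilted {d} fun _ => 1
    have hm : MeasurableSet (⋃ j, B d j) := MeasurableSet.iUnion (hBm d)
    -- Both tilted measures have the same finite total mass, and the transferred cover has at least
    -- that mass.
    have h0 : tilted μ₂ y₂ {d} (fun _ => 1) (⋃ j, B d j)ᶜ = 0 := by
      rw [measure_compl hm (measure_ne_top _ _), tsub_eq_zero_iff_le, tilted_univ, ← h,
        ← tilted_univ]
      refine le_trans (le_of_eq ?_) (hle d)
      refine (measure_congr ?_).symm
      rw [ae_eq_univ]
      exact tilted_absolutelyContinuous hc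
    rw [tilted, withDensity_apply_eq_zero (h₂.measurable_maxLin _ _)] at h0
    filter_upwards [measure_eq_zero_iff_ae_notMem.1 h0] with s' hs' hs
    by_contra hne
    exact hs' ⟨by simpa [maxLin] using hne, hs⟩
  refine ⟨fun j => ⋃ d ∈ D, B d j, fun j => MeasurableSet.biUnion hD fun d _ => hBm d j, ?_, ?_⟩
  · intro j s' hs'
    obtain ⟨d, -, hd⟩ := mem_iUnion₂.1 hs'
    exact hB d j s' hd
  · intro t
    have : ∀ᵐ s' ∂μ₂, ∀ d ∈ D, s' ∉ ⋃ j, B d j → y₂ d s' = 0 :=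
      (ae_ball_iff hD).2 fun d _ => key d
    filter_upwards [hsupp t, this] with s' h1 h2 hs'
    refine h1 fun d hd => h2 d hd fun hmem => hs' ?_
    obtain ⟨j, hj⟩ := mem_iUnion.1 hmem
    exact mem_iUnion.2 ⟨j, mem_iUnion₂.2 ⟨d, hd, hj⟩⟩

end Compare

/-! ### The function `exp (-a)` on `[0, ∞]` -/

/-- The function `a ↦ exp (-a)` on `[0, ∞]`. -/
def expNeg (a : ℝ≥0∞) : ℝ≥0∞ := EReal.exp (-(a : EReal))

@[simp] theorem expNeg_zero : expNeg 0 = 1 := by simp [expNeg]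

theorem expNeg_add (a b : ℝ≥0∞) : expNeg (a + b) = expNeg a * expNeg b := by
  rw [expNeg, EReal.coe_ennreal_add, EReal.neg_add (.inl (EReal.coe_ennreal_ne_bot _))
    (.inr (EReal.coe_ennreal_ne_bot _)), sub_eq_add_neg, EReal.exp_add, expNeg, expNeg]

theorem expNeg_sum {ι : Type*} (s : Finset ι) (a : ι → ℝ≥0∞) :
    expNeg (∑ i ∈ s, a i) = ∏ i ∈ s, expNeg (a i) := by
  classical
  induction s using Finset.induction_on with
  | empty => simp
  | insert i s hi ih => rw [Finset.sum_insert hi, Finset.prod_insert hi, expNeg_add, ih]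

theorem expNeg_injective : Function.Injective expNeg := fun a b h => by
  have := EReal.exp_strictMono.injective h
  exact EReal.coe_ennreal_injective (neg_injective this)

theorem continuous_expNeg : Continuous expNeg :=
  ENNReal.continuous_exp.comp (continuous_neg.comp continuous_coe_ennreal_ereal)

/-! ### Joint laws of extremal integrals. -/

namespace IsFrechetSupMeasure
variable {S Ω : Type*} [MeasurableSpace S] [MeasurableSpace Ω] {P : Measure Ω}
  {α : ℝ} {μ : Measure S} {M : Set S → Ω → ℝ≥0∞}

theorem measurable_simpleExtremalIntegral (hM : IsFrechetSupMeasure P α μ M)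
    (φ : SimpleFunc S ℝ≥0∞) : Measurable (simpleExtremalIntegral M φ) := by
  unfold simpleExtremalIntegral
  simp only [Finset.sup_eq_iSup]
  exact Measurable.biSup _ φ.range.countable_toSet fun a _ =>
    (hM.measurable _ (φ.measurableSet_fiber a)).const_mul _

theorem measurable_extremalIntegral (hM : IsFrechetSupMeasure P α μ M) (g : S → ℝ≥0∞) :
    Measurable (extremalIntegral M g) :=
  Measurable.iSup fun _ => hM.measurable_simpleExtremalIntegral _

variable [IsProbabilityMeasure P]

/-- The product form of the event keeps `c = 0` admissible, which occurs on cells where all the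
functions vanish. -/
theorem measure_le (hM : IsFrechetSupMeasure P α μ M) (hα : 0 < α) {A : Set S}
    (hA : MeasurableSet A) {c : ℝ≥0∞} (hc : c ≠ ∞) :
    P {ω | M A ω * c ≤ 1} = expNeg (c ^ α * μ A) := by
  rcases eq_or_ne c 0 with rfl | hc0
  · simp [hα]
  lift c to ℝ≥0 using hc
  have hc0' : c ≠ 0 := by simpa using hc0
  have h := hM.law A hA c⁻¹ (inv_pos.2 (pos_iff_ne_zero.2 hc0'))
  have hset : {ω | M A ω * c ≤ 1} = {ω | M A ω ≤ (c⁻¹ : ℝ≥0)} := by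
    ext ω
    rw [mem_ofPred_eq, mem_ofPred_eq, ENNReal.coe_inv hc0', ENNReal.le_inv_iff_mul_le]
  rw [hset, h, ENNReal.coe_inv hc0', div_eq_mul_inv, inv_inv, ENNReal.mul_rpow_of_nonneg _ _ hα.le,
    ← ENNReal.rpow_mul, one_div, inv_mul_cancel₀ hα.ne', ENNReal.rpow_one, mul_comm, expNeg]

theorem ae_empty (hM : IsFrechetSupMeasure P α μ M) (hα : 0 < α) : M ∅ =ᵐ[P] 0 := by
  have h : ∀ᵐ ω ∂P, ∀ n : ℕ, M ∅ ω * n ≤ 1 := by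
    rw [ae_all_iff]
    intro n
    have h1 := hM.measure_le hα MeasurableSet.empty (ENNReal.natCast_ne_top n)
    rw [measure_empty, mul_zero, expNeg_zero] at h1
    have hm : MeasurableSet {ω | M ∅ ω * n ≤ 1} :=
      measurableSet_le ((hM.measurable _ .empty).mul_const _) measurable_const
    rw [ae_iff]
    exact (prob_compl_eq_zero_iff hm).2 h1
  filter_upwards [h] with ω hω
  by_contra hne
  have hne : M ∅ ω ≠ 0 := hne
  obtain ⟨n, hn⟩ := ENNReal.exists_nat_mul_gt hne ENNReal.one_ne_top
  rw [mul_comm] at hn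
  exact (hω n).not_gt hn

theorem ae_union (hM : IsFrechetSupMeasure P α μ M) (hα : 0 < α) {A B : Set S}
    (hA : MeasurableSet A) (hB : MeasurableSet B) (hAB : Disjoint A B) :
    M (A ∪ B) =ᵐ[P] fun ω => M A ω ⊔ M B ω := by
  -- Padding by `∅` is harmless because `M ∅ = 0` almost surely.
  let C : ℕ → Set S := fun n => if n = 0 then A else if n = 1 then B else ∅
  have hC : ⋃ n, C n = A ∪ B := by
    ext s
    simp only [mem_iUnion, mem_union]
    constructor
    · rintro ⟨n, hn⟩
      simp only [C] at hn
      split_ifs at hn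
      · exact Or.inl hn
      · exact Or.inr hn
      · exact hn.elim
    · rintro (h | h)
      · exact ⟨0, by simpa [C] using h⟩
      · exact ⟨1, by simpa [C] using h⟩
  have h := hM.iUnion C (fun n => by simp only [C]; split_ifs <;> simp [hA, hB]) (by
    intro m n hmn
    simp only [C]
    split_ifs <;> first | omega | simp [hAB.symm])
  rw [hC] at h
  filter_upwards [h, hM.ae_empty hα] with ω h1 h2
  rw [h1]
  refine le_antisymm (iSup_le fun n => ?_) (sup_le ?_ ?_)
  · simp only [C]
    split_ifs
    · exact le_sup_left
    · exact le_sup_right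
    · rw [h2]; exact zero_le
  · exact le_iSup_of_le 0 (by simp [C])
  · exact le_iSup_of_le 1 (by simp [C])

theorem ae_biUnion_finset (hM : IsFrechetSupMeasure P α μ M) (hα : 0 < α) {β : Type*}
    {A : β → Set S} (hA : ∀ b, MeasurableSet (A b)) (hd : Pairwise fun b c => Disjoint (A b) (A c))
    (s : Finset β) : M (⋃ b ∈ s, A b) =ᵐ[P] fun ω => s.sup fun b => M (A b) ω := by
  classical
  induction s using Finset.induction_on with
  | empty => simpa using! hM.ae_empty hα
  | insert b s hb ih =>
    rw [Finset.set_biUnion_insert]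
    have hdisj : Disjoint (A b) (⋃ c ∈ s, A c) := by
      simp only [disjoint_iUnion_right]
      exact fun c hc => hd fun h => hb (h ▸ hc)
    filter_upwards [hM.ae_union hα (hA b) (s.measurableSet_biUnion fun c _ => hA c) hdisj, ih]
      with ω h1 h2
    rw [h1, h2, Finset.sup_insert]

/-- The extremal integral of a simple function that is constant on the cells of a finer partition. -/
theorem ae_simpleExtremalIntegral_map (hM : IsFrechetSupMeasure P α μ M) (hα : 0 < α) {β : Type*}
    (Φ : SimpleFunc S β) (h : β → ℝ≥0∞) :
    simpleExtremalIntegral M (Φ.map h)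
      =ᵐ[P] fun ω => Φ.range.sup fun b => h b * M (Φ ⁻¹' {b}) ω := by
  classical
  have key : ∀ᵐ ω ∂P, ∀ b ∈ Φ.range, M (Φ.map h ⁻¹' {h b}) ω
      = (Φ.range.filter fun c => h c = h b).sup fun c => M (Φ ⁻¹' {c}) ω := by
    refine (ae_ball_iff Φ.range.countable_toSet).2 fun b _ => ?_
    have h1 := hM.ae_biUnion_finset hα (A := fun c => Φ ⁻¹' {c})
      (fun c => Φ.measurableSet_fiber c)
      (fun c d hcd => Disjoint.preimage _ (disjoint_singleton.2 hcd))
      (Φ.range.filter fun c => h c = h b)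
    have hset : Φ.map h ⁻¹' {h b}
        = ⋃ c ∈ Φ.range.filter fun c => h c = h b, Φ ⁻¹' {c} := by
      ext s
      simp
    rw [hset]
    exact h1
  filter_upwards [key] with ω hω
  rw [simpleExtremalIntegral, SimpleFunc.range_map, Finset.sup_image]
  refine le_antisymm (Finset.sup_le fun b hb => ?_) (Finset.sup_le fun b hb => ?_)
  · simp only [Function.comp_apply]
    rw [hω b hb]
    obtain ⟨c, hc, hmax⟩ := Finset.exists_mem_eq_sup (Φ.range.filter fun c => h c = h b)
      ⟨b, by simpa using hb⟩ fun c => M (Φ ⁻¹' {c}) ω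
    rw [hmax]
    rw [Finset.mem_filter] at hc
    rw [← hc.2]
    exact Finset.le_sup (f := fun b => h b * M (Φ ⁻¹' {b}) ω) hc.1
  · refine le_trans ?_ (Finset.le_sup hb)
    simp only [Function.comp_apply]
    rw [hω b hb]
    gcongr
    exact Finset.le_sup (f := fun c => M (Φ ⁻¹' {c}) ω) (by simpa using hb)

/-- Joint law of the extremal integrals of simple functions. -/
theorem measure_simpleExtremalIntegral_le (hM : IsFrechetSupMeasure P α μ M) (hα : 0 < α)
    {β ι : Type*} (Φ : SimpleFunc S β) (h : ι → β → ℝ≥0∞) (hfin : ∀ i b, h i b ≠ ∞) (I : Finset ι)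
    (x : ι → ℝ≥0) (hx : ∀ i, 0 < x i) :
    P {ω | ∀ i ∈ I, simpleExtremalIntegral M (Φ.map (h i)) ω ≤ x i}
      = expNeg (∫⁻ s, I.sup fun i => (h i (Φ s) / x i) ^ α ∂μ) := by
  classical
  -- All constraints on the cell `b` collapse to the single bound `M (cell) * c b ≤ 1`, so
  -- independence over the cells applies.
  let c : β → ℝ≥0∞ := fun b => I.sup fun i => h i b / x i
  have hxne : ∀ i, (x i : ℝ≥0∞) ≠ 0 := fun i => by simpa using (hx i).ne'
  have hc : ∀ b, c b ≠ ∞ := fun b => ((Finset.sup_lt_iff ENNReal.zero_lt_top).2 fun i _ =>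
    ENNReal.div_lt_top (hfin i b) (hxne i)).ne
  have hcα : ∀ b, c b ^ α = I.sup fun i => (h i b / x i) ^ α := fun b =>
    Finset.apply_sup_eq_sup_comp_of_linearOrder (fun y : ℝ≥0∞ => y ^ α)
      (ENNReal.monotone_rpow_of_nonneg hα.le) (by simp [hα])
  have hev : P {ω | ∀ i ∈ I, simpleExtremalIntegral M (Φ.map (h i)) ω ≤ x i}
      = P (⋂ b : Φ.range, {ω | M (Φ ⁻¹' {b.1}) ω * c b ≤ 1}) := by
    refine measure_congr ?_
    have h1 : ∀ᵐ ω ∂P, ∀ i ∈ I, simpleExtremalIntegral M (Φ.map (h i)) ω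
        = Φ.range.sup fun b => h i b * M (Φ ⁻¹' {b}) ω :=
      (ae_ball_iff I.countable_toSet).2 fun i _ => hM.ae_simpleExtremalIntegral_map hα Φ (h i)
    filter_upwards [h1] with ω hω
    refine propext ?_
    change (∀ i ∈ I, simpleExtremalIntegral M (Φ.map (h i)) ω ≤ x i)
      ↔ ω ∈ ⋂ b : Φ.range, {ω | M (Φ ⁻¹' {b.1}) ω * c b ≤ 1}
    have h2 : ∀ b, (M (Φ ⁻¹' {b}) ω * c b ≤ 1 ↔ ∀ i ∈ I, h i b * M (Φ ⁻¹' {b}) ω ≤ x i) := by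
      intro b
      have : M (Φ ⁻¹' {b}) ω * c b = I.sup fun i => M (Φ ⁻¹' {b}) ω * (h i b / x i) :=
        Finset.apply_sup_eq_sup_comp_of_linearOrder (fun y : ℝ≥0∞ => M (Φ ⁻¹' {b}) ω * y)
          (fun _ _ hab => mul_le_mul_right hab _) (by simp)
      rw [this, Finset.sup_le_iff]
      refine forall₂_congr fun i _ => ?_
      rw [← mul_div_assoc, ENNReal.div_le_iff (hxne i) ENNReal.coe_ne_top, one_mul, mul_comm]
    simp only [mem_iInter, mem_ofPred_eq, h2]
    constructor
    · rintro h b i hi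
      have := h i hi
      rw [hω i hi, Finset.sup_le_iff] at this
      exact this b.1 b.2
    · intro h i hi
      rw [hω i hi, Finset.sup_le_iff]
      exact fun b hb => h ⟨b, hb⟩ i hi
  have hmeas : ∀ b, MeasurableSet {y : ℝ≥0∞ | y * c b ≤ 1} := fun b =>
    measurableSet_le (measurable_id.mul_const _) measurable_const
  let e := Φ.range.equivFin
  have hind := hM.indep Φ.range.card (fun k => Φ ⁻¹' {(e.symm k).1})
    (fun k => Φ.measurableSet_fiber _) (fun k l hkl => Disjoint.preimage _
      (disjoint_singleton.2 fun h => hkl (e.symm.injective (Subtype.ext h))))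
  have hprod := hind.meas_iInter (s := fun k => {ω | M (Φ ⁻¹' {(e.symm k).1}) ω * c (e.symm k) ≤ 1})
    fun k => ⟨_, hmeas (e.symm k), rfl⟩
  have hre : (⋂ b : Φ.range, {ω | M (Φ ⁻¹' {b.1}) ω * c b ≤ 1})
      = ⋂ k, {ω | M (Φ ⁻¹' {(e.symm k).1}) ω * c (e.symm k) ≤ 1} :=
    (e.symm.surjective.iInter_comp fun b : Φ.range => {ω | M (Φ ⁻¹' {b.1}) ω * c b ≤ 1}).symm
  rw [hev, hre, hprod, e.symm.prod_comp fun b : Φ.range => P {ω | M (Φ ⁻¹' {b.1}) ω * c b ≤ 1},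
    Finset.prod_coe_sort Φ.range fun b => P {ω | M (Φ ⁻¹' {b}) ω * c b ≤ 1}]
  have hint : ∫⁻ s, I.sup (fun i => (h i (Φ s) / x i) ^ α) ∂μ
      = ∑ b ∈ Φ.range, c b ^ α * μ (Φ ⁻¹' {b}) := by
    rw [← SimpleFunc.map_lintegral (fun b => c b ^ α) Φ, ← SimpleFunc.lintegral_eq_lintegral]
    refine lintegral_congr fun s => ?_
    rw [SimpleFunc.map_apply, hcα]
  rw [hint, expNeg_sum]
  exact Finset.prod_congr rfl fun b _ => hM.measure_le hα (Φ.measurableSet_fiber b) (hc b)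

end IsFrechetSupMeasure

theorem exists_simpleFunc_pi {S ι : Type*} [MeasurableSpace S] [Finite ι]
    (φ : ι → SimpleFunc S ℝ≥0∞) :
    ∃ Φ : SimpleFunc S (ι → ℝ≥0), ∀ s i, Φ s i = (φ i s).toNNReal := by
  refine ⟨⟨fun s i => (φ i s).toNNReal, fun x => ?_, ?_⟩, fun _ _ => rfl⟩
  · have : (fun s i => (φ i s).toNNReal) ⁻¹' {x}
        = ⋂ i, (φ i).map ENNReal.toNNReal ⁻¹' {x i} := by
      ext s
      simp [funext_iff]
    rw [this]
    exact MeasurableSet.iInter fun i => SimpleFunc.measurableSet_fiber _ _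
  · refine (Finite.pi' fun i => ((φ i).map ENNReal.toNNReal).finite_range).subset ?_
    rintro _ ⟨s, rfl⟩ i
    exact ⟨s, rfl⟩

namespace IsFrechetSupMeasure
variable {S Ω : Type*} [MeasurableSpace S] [MeasurableSpace Ω] {P : Measure Ω}
  [IsProbabilityMeasure P] {α : ℝ} {μ : Measure S} {M : Set S → Ω → ℝ≥0∞}

/-- Over the common partition into level sets of the pair the comparison is cellwise. It holds only
almost surely, because `M` is max-additive only almost surely. -/
theorem ae_simpleExtremalIntegral_mono (hM : IsFrechetSupMeasure P α μ M) (hα : 0 < α)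
    {φ ψ : SimpleFunc S ℝ≥0∞} (hle : φ ≤ ψ) :
    ∀ᵐ ω ∂P, simpleExtremalIntegral M φ ω ≤ simpleExtremalIntegral M ψ ω := by
  have h1 := hM.ae_simpleExtremalIntegral_map hα (φ.pair ψ) Prod.fst
  have h2 := hM.ae_simpleExtremalIntegral_map hα (φ.pair ψ) Prod.snd
  have e1 : (φ.pair ψ).map Prod.fst = φ := rfl
  have e2 : (φ.pair ψ).map Prod.snd = ψ := rfl
  rw [e1] at h1
  rw [e2] at h2
  filter_upwards [h1, h2] with ω h1 h2
  rw [h1, h2]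
  refine Finset.sup_mono_fun fun b hb => ?_
  obtain ⟨s, rfl⟩ := SimpleFunc.mem_range.1 hb
  gcongr
  exact hle s

/-- Joint law of the extremal integrals of measurable functions. -/
theorem measure_extremalIntegral_le (hM : IsFrechetSupMeasure P α μ M) (hα : 0 < α) {ι : Type*}
    (g : ι → S → ℝ≥0∞) (hg : ∀ i, Measurable (g i)) (I : Finset ι) (x : ι → ℝ≥0)
    (hx : ∀ i, 0 < x i) :
    P {ω | ∀ i ∈ I, extremalIntegral M (g i) ω ≤ x i}
      = expNeg (∫⁻ s, I.sup fun i => (g i s / x i) ^ α ∂μ) := by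
  classical
  let E : ℕ → Set Ω := fun n =>
    {ω | ∀ i ∈ I, simpleExtremalIntegral M (SimpleFunc.eapprox (g i) n) ω ≤ x i}
  have hE : ∀ n, MeasurableSet (E n) := fun n => by
    simp only [E, ofPred_forall]
    exact I.measurableSet_biInter fun i _ =>
      measurableSet_le (hM.measurable_simpleExtremalIntegral _) measurable_const
  have hset : {ω | ∀ i ∈ I, extremalIntegral M (g i) ω ≤ x i} = ⋂ n, E n := by
    ext ω
    simp only [extremalIntegral, iSup_le_iff, mem_ofPred_eq, mem_iInter, E]
    exact ⟨fun h n i hi => h i hi n, fun h i hi n => h n i hi⟩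
  -- The `E n` decrease only up to null sets, so continuity from above is applied to finite
  -- intersections.
  have hmono : ∀ n, P (⋂ k ≤ n, E k) = P (E n) := by
    intro n
    refine le_antisymm (measure_mono (biInter_subset_of_mem (le_refl n))) (measure_mono_ae ?_)
    have : ∀ᵐ ω ∂P, ∀ k ∈ Iic n, ∀ i ∈ I, simpleExtremalIntegral M (SimpleFunc.eapprox (g i) k) ω
        ≤ simpleExtremalIntegral M (SimpleFunc.eapprox (g i) n) ω :=
      (ae_ball_iff (finite_Iic n).countable).2 fun k hk =>
        (ae_ball_iff I.countable_toSet).2 fun i _ =>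
          hM.ae_simpleExtremalIntegral_mono hα (SimpleFunc.monotone_eapprox _ hk)
    filter_upwards [this] with ω hω hn
    exact mem_iInter₂.2 fun k hk i hi => (hω k hk i hi).trans (hn i hi)
  have hval : ∀ n, P (E n)
      = expNeg (∫⁻ s, I.sup fun i => (SimpleFunc.eapprox (g i) n s / x i) ^ α ∂μ) := by
    intro n
    obtain ⟨Φ, hΦ⟩ := exists_simpleFunc_pi fun i : I => SimpleFunc.eapprox (g i) n
    let h : I → (I → ℝ≥0) → ℝ≥0∞ := fun i v => v i
    have hmap : ∀ i : I, Φ.map (h i) = SimpleFunc.eapprox (g i) n := by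
      intro i
      ext s
      simp [h, hΦ, ENNReal.coe_toNNReal (SimpleFunc.eapprox_lt_top _ _ _).ne]
    have key := hM.measure_simpleExtremalIntegral_le hα Φ h (fun _ _ => ENNReal.coe_ne_top)
      Finset.univ (fun i : I => x i) fun i => hx i
    have hE' : E n = {ω | ∀ i ∈ (Finset.univ : Finset I),
        simpleExtremalIntegral M (Φ.map (h i)) ω ≤ x i} := by
      ext ω
      simp [E, hmap]
    rw [hE', key]
    congr 1
    refine lintegral_congr fun s => ?_
    have : ∀ i : I, h i (Φ s) = SimpleFunc.eapprox (g i) n s := fun i => by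
      rw [← hmap i, SimpleFunc.map_apply]
    simp only [this]
    rw [Finset.univ_eq_attach,
      Finset.sup_attach I fun i => (SimpleFunc.eapprox (g i) n s / (x i : ℝ≥0∞)) ^ α]
  have h1 := tendsto_measure_iInter_le (μ := P) (fun n => (hE n).nullMeasurableSet)
    ⟨0, measure_ne_top _ _⟩
  simp only [hmono, hval] at h1
  rw [hset]
  refine tendsto_nhds_unique h1 (continuous_expNeg.continuousAt.tendsto.comp ?_)
  have hpow : Monotone fun y : ℝ≥0∞ => y ^ α := ENNReal.monotone_rpow_of_nonneg hα.le
  refine lintegral_tendsto_of_tendsto_of_monotone (fun n => ?_) (ae_of_all _ fun s => ?_)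
    (ae_of_all _ fun s => ?_)
  · simp only [Finset.sup_eq_iSup]
    exact (Measurable.biSup _ I.countable_toSet fun i _ =>
      ((SimpleFunc.measurable _).div_const _).pow_const _).aemeasurable
  · intro m n hmn
    refine Finset.sup_mono_fun fun i _ => hpow ?_
    exact ENNReal.div_le_div_right (SimpleFunc.monotone_eapprox _ hmn s) _
  · have hcont : ∀ i, Filter.Tendsto (fun n => (SimpleFunc.eapprox (g i) n s / (x i : ℝ≥0∞)) ^ α)
        Filter.atTop (nhds ((g i s / x i) ^ α)) := fun i =>
      (ENNReal.continuous_rpow_const.tendsto _).comp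
        (ENNReal.Tendsto.div_const (SimpleFunc.tendsto_eapprox (hg i) s)
          (Or.inr (by simpa using (hx i).ne')))
    exact Filter.Tendsto.finset_sup_nhds_apply fun i _ => hcont i

end IsFrechetSupMeasure

/-! ### Extremal processes over a set. -/

/-- The `α`-th powers of a spectral family. -/
def powFamily {T S : Type*} (α : ℝ) (f : T → S → ℝ≥0) (t : T) (s : S) : ℝ≥0∞ :=
  (f t s : ℝ≥0∞) ^ α

theorem isSpectralFamily_powFamily {T S : Type*} [MeasurableSpace T] [MeasurableSpace S] {α : ℝ}
    (hα : 0 < α) {μ : Measure S} {f : T → S → ℝ≥0} (hf : Measurable (Function.uncurry f))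
    (hint : ∀ t, ∫⁻ s, (f t s : ℝ≥0∞) ^ α ∂μ < ∞) : IsSpectralFamily μ (powFamily α f) where
  measurable := (measurable_coe_nnreal_ennreal.comp hf).pow_const α
  ne_top _ _ := ENNReal.rpow_ne_top_of_nonneg hα.le ENNReal.coe_ne_top
  integrable := hint

/-- The coefficients `(c t) ^ (-α)`. -/
def invPow {T : Type*} (α : ℝ) (c : T → ℝ≥0) (t : T) : ℝ≥0 := (c t)⁻¹ ^ α

theorem indicator_div_rpow {T S : Type*} {α : ℝ} (hα : 0 < α) (f : T → S → ℝ≥0) (A : Set S) (t : T)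
    (s : S) {c : ℝ≥0} (hc : 0 < c) :
    (A.indicator (fun s => (f t s : ℝ≥0∞)) s / c) ^ α
      = A.indicator (fun s => ((c⁻¹ ^ α : ℝ≥0) : ℝ≥0∞) * powFamily α f t s) s := by
  by_cases hs : s ∈ A
  · rw [indicator_of_mem hs, indicator_of_mem hs, div_eq_mul_inv, ENNReal.mul_rpow_of_nonneg _ _ hα.le,
      ← ENNReal.coe_inv hc.ne', ENNReal.coe_rpow_of_nonneg _ hα.le, mul_comm, powFamily]
  · rw [indicator_of_notMem hs, indicator_of_notMem hs]
    simp [hα]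

theorem sup_indicator_div_rpow {T S : Type*} {α : ℝ} (hα : 0 < α) (f : T → S → ℝ≥0) (A : Set S)
    (s : S) (I : Finset T) {c : T → ℝ≥0} (hc : ∀ t, 0 < c t) :
    (I.sup fun t => (A.indicator (fun s => (f t s : ℝ≥0∞)) s / c t) ^ α)
      = A.indicator (fun s => maxLin I (invPow α c) fun t => powFamily α f t s) s := by
  simp only [fun t => indicator_div_rpow hα f A t s (hc t)]
  by_cases hs : s ∈ A
  · simp only [indicator_of_mem hs]; rfl
  · simp only [indicator_of_notMem hs]
    exact Finset.sup_bot I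

theorem measurable_extremalProcess {T S Ω : Type*} [MeasurableSpace S] [MeasurableSpace Ω]
    {P : Measure Ω} {α : ℝ} {μ : Measure S} {M : Set S → Ω → ℝ≥0∞} {f : T → S → ℝ≥0}
    (hM : IsFrechetSupMeasure P α μ M) (A : Set S) (t : T) :
    Measurable (extremalProcess M f A t) :=
  hM.measurable_extremalIntegral _

theorem measurable_indicator_coe {T S : Type*} [MeasurableSpace T] [MeasurableSpace S]
    {f : T → S → ℝ≥0} (hf : Measurable (Function.uncurry f)) {A : Set S}
    (hA : MeasurableSet A) (t : T) : Measurable (A.indicator fun s => (f t s : ℝ≥0∞)) :=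
  (measurable_coe_nnreal_ennreal.comp (hf.comp measurable_prodMk_left)).indicator hA

section ExtremalProcess
variable {T S Ω : Type*} [MeasurableSpace T] [MeasurableSpace S] [MeasurableSpace Ω]
  {P : Measure Ω} [IsProbabilityMeasure P] {α : ℝ} {μ : Measure S} {M : Set S → Ω → ℝ≥0∞}
  {f : T → S → ℝ≥0}

/-- The dictionary between laws and measures: comparing components of two representations becomes
comparing tilted masses. -/
theorem measure_extremalProcess_le (hM : IsFrechetSupMeasure P α μ M) (hα : 0 < α)
    (hf : Measurable (Function.uncurry f)) {A : Set S} (hA : MeasurableSet A) (I : Finset T)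
    (c : T → ℝ≥0) (hc : ∀ t, 0 < c t) :
    P {ω | ∀ t ∈ I, extremalProcess M f A t ω ≤ c t}
      = expNeg (tilted μ (powFamily α f) I (invPow α c) A) := by
  rw [tilted, withDensity_apply _ hA, ← lintegral_indicator hA]
  simp only [← fun s => sup_indicator_div_rpow hα f A s I hc]
  exact hM.measure_extremalIntegral_le hα _ (fun t => measurable_indicator_coe hf hA t) I c hc

/-- Joint law of the extremal processes over almost disjoint sets. -/
theorem measure_forall_extremalProcess_le (hM : IsFrechetSupMeasure P α μ M) (hα : 0 < α)
    (hf : Measurable (Function.uncurry f)) {n : ℕ} {A : Fin n → Set S}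
    (hA : ∀ j, MeasurableSet (A j)) (hd : Pairwise fun j k => AEDisjoint μ (A j) (A k))
    (J : Finset (Fin n)) (I : Fin n → Finset T) (c : Fin n → T → ℝ≥0) (hc : ∀ j t, 0 < c j t) :
    P {ω | ∀ j ∈ J, ∀ t ∈ I j, extremalProcess M f (A j) t ω ≤ c j t}
      = ∏ j ∈ J, P {ω | ∀ t ∈ I j, extremalProcess M f (A j) t ω ≤ c j t} := by
  have h1 := hM.measure_extremalIntegral_le hα
    (fun p : Σ _ : Fin n, T => (A p.1).indicator fun s => (f p.2 s : ℝ≥0∞))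
    (fun p => measurable_indicator_coe hf (hA p.1) p.2) (J.sigma I) (fun p => c p.1 p.2)
    fun p => hc p.1 p.2
  have hset : {ω | ∀ j ∈ J, ∀ t ∈ I j, extremalProcess M f (A j) t ω ≤ c j t}
      = {ω | ∀ p ∈ J.sigma I, extremalIntegral M
          ((A p.1).indicator fun s => (f p.2 s : ℝ≥0∞)) ω ≤ c p.1 p.2} := by
    ext ω
    simp only [mem_ofPred_eq, Finset.mem_sigma, Sigma.forall, extremalProcess]
    exact ⟨fun h j t hjt => h j hjt.1 t hjt.2, fun h j hj t ht => h j t ⟨hj, ht⟩⟩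
  rw [hset, h1]
  simp only [measure_extremalProcess_le hM hα hf (hA _) _ _ (hc _)]
  rw [← expNeg_sum]
  congr 1
  have hmax : ∀ j, Measurable fun s =>
      (A j).indicator (fun s => maxLin (I j) (invPow α (c j)) fun t => powFamily α f t s) s := by
    intro j
    refine Measurable.indicator ((measurable_maxLin _ _).comp (measurable_pi_lambda _ fun t => ?_))
      (hA j)
    exact (measurable_coe_nnreal_ennreal.comp (hf.comp measurable_prodMk_left)).pow_const α
  have hT : ∀ j, tilted μ (powFamily α f) (I j) (invPow α (c j)) (A j)
      = ∫⁻ s, (A j).indicator (fun s => maxLin (I j) (invPow α (c j)) fun t => powFamily α f t s) s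
        ∂μ := fun j => by
    rw [tilted, withDensity_apply _ (hA j), ← lintegral_indicator (hA j)]
  simp only [hT]
  rw [← lintegral_finsetSum _ fun j _ => hmax j]
  have hae : ∀ᵐ s ∂μ, ∀ j k, j ≠ k → ¬ (s ∈ A j ∧ s ∈ A k) := by
    rw [ae_all_iff]; intro j
    rw [ae_all_iff]; intro k
    by_cases hjk : j = k
    · simp [hjk]
    · filter_upwards [measure_eq_zero_iff_ae_notMem.1 (hd hjk)] with s hs _ using hs
  -- Almost every `s` lies in at most one `A j`, so the maximum over `j` under the integral is a sum
  -- over `j`.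
  refine lintegral_congr_ae ?_
  filter_upwards [hae] with s hs
  rw [Finset.sup_sigma]
  simp only [fun j => sup_indicator_div_rpow hα f (A j) s (I j) (hc j)]
  by_cases hex : ∃ j ∈ J, s ∈ A j
  · obtain ⟨j, hj, hsj⟩ := hex
    have hzero : ∀ k ∈ J, k ≠ j → (A k).indicator (fun s => maxLin (I k) (invPow α (c k)) fun t =>
        powFamily α f t s) s = 0 := fun k _ hk =>
      indicator_of_notMem (fun hsk => hs k j hk ⟨hsk, hsj⟩) _
    rw [Finset.sum_eq_single_of_mem j hj hzero]
    refine le_antisymm (Finset.sup_le fun k hk => ?_) (Finset.le_sup (f := fun k => (A k).indicator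
      (fun s => maxLin (I k) (invPow α (c k)) fun t => powFamily α f t s) s) hj)
    by_cases hkj : k = j
    · rw [hkj]
    · rw [hzero k hk hkj]; exact zero_le
  · have hzero : ∀ k ∈ J, (A k).indicator (fun s => maxLin (I k) (invPow α (c k)) fun t =>
        powFamily α f t s) s = 0 := fun k hk =>
      indicator_of_notMem (fun hsk => hex ⟨k, hk, hsk⟩) _
    rw [Finset.sum_eq_zero hzero, Finset.sup_congr rfl hzero]
    exact Finset.sup_bot J

theorem isFrechetProcess_extremalProcess (hM : IsFrechetSupMeasure P α μ M) (hα : 0 < α)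
    (hf : Measurable (Function.uncurry f)) (hint : ∀ t, ∫⁻ s, (f t s : ℝ≥0∞) ^ α ∂μ < ∞)
    {A : Set S} (hA : MeasurableSet A) : IsFrechetProcess P α (extremalProcess M f A) := by
  refine ⟨measurable_extremalProcess hM A, fun m a t ha => ?_⟩
  let g : Fin (m + 1) → S → ℝ≥0∞ := fun i => A.indicator fun s => (f (t i) s : ℝ≥0∞)
  have hg : ∀ i, Measurable (g i) := fun i => measurable_indicator_coe hf hA (t i)
  let K : ℝ≥0∞ := ∫⁻ s, Finset.univ.sup fun i => ((a i : ℝ≥0∞) * g i s) ^ α ∂μ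
  have hK : K ≠ ∞ := by
    refine ne_top_of_le_ne_top (b := ∑ i, (a i : ℝ≥0∞) ^ α * ∫⁻ s, (f (t i) s : ℝ≥0∞) ^ α ∂μ) ?_ ?_
    · exact (ENNReal.sum_lt_top.2 fun i _ => ENNReal.mul_lt_top
        (ENNReal.rpow_lt_top_of_nonneg hα.le ENNReal.coe_ne_top) (hint _)).ne
    · have hfm : ∀ i, Measurable fun s => (f (t i) s : ℝ≥0∞) ^ α := fun i =>
        (measurable_coe_nnreal_ennreal.comp (hf.comp measurable_prodMk_left)).pow_const α
      rw [Finset.sum_congr rfl fun i _ => (lintegral_const_mul ((a i : ℝ≥0∞) ^ α) (hfm i)).symm,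
        ← lintegral_finsetSum _ fun i _ => (hfm i).const_mul _]
      refine lintegral_mono fun s => Finset.sup_le fun i hi => ?_
      refine le_trans ?_ (Finset.single_le_sum
        (f := fun i => (a i : ℝ≥0∞) ^ α * (f (t i) s : ℝ≥0∞) ^ α) (fun _ _ => zero_le) hi)
      rw [ENNReal.mul_rpow_of_nonneg _ _ hα.le]
      gcongr
      exact indicator_le_self _ _ _
  -- By homogeneity `x ^ (-α)` factors out of the integral and leaves `K`, the `α`-th power of the
  -- scale.
  refine ⟨(K ^ (1 / α)).toNNReal, fun x hx => ?_⟩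
  have hx' : (x : ℝ≥0∞) ≠ 0 := by simpa using hx.ne'
  have ha' : ∀ i, (a i : ℝ≥0∞) ≠ 0 := fun i => by simpa using (ha i).ne'
  have h1 := hM.measure_extremalIntegral_le hα g hg Finset.univ (fun i => x / a i)
    fun i => div_pos hx (ha i)
  have hset : {ω | ⨆ i, (a i : ℝ≥0∞) * extremalProcess M f A (t i) ω ≤ x}
      = {ω | ∀ i ∈ Finset.univ, extremalIntegral M (g i) ω ≤ (x / a i : ℝ≥0)} := by
    ext ω
    simp only [mem_ofPred_eq, iSup_le_iff, Finset.mem_univ, true_imp_iff]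
    refine forall_congr' fun i => ?_
    rw [ENNReal.coe_div (ha i).ne', ENNReal.le_div_iff_mul_le (Or.inl (ha' i))
      (Or.inl ENNReal.coe_ne_top), mul_comm]
    rfl
  rw [hset, h1, expNeg, ENNReal.coe_toNNReal (ENNReal.rpow_ne_top_of_nonneg (by positivity) hK),
    ENNReal.div_rpow_of_nonneg _ _ hα.le, ← ENNReal.rpow_mul, one_div, inv_mul_cancel₀ hα.ne',
    ENNReal.rpow_one, div_eq_mul_inv]
  congr 3
  have hxα : ((x : ℝ≥0∞) ^ α)⁻¹ ≠ ∞ := by simp [hx.ne']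
  rw [← lintegral_mul_const' _ _ hxα]
  refine lintegral_congr fun s => ?_
  rw [Finset.apply_sup_eq_sup_comp_of_linearOrder (fun y : ℝ≥0∞ => y * ((x : ℝ≥0∞) ^ α)⁻¹)
    (fun _ _ h => mul_le_mul_left h _) (by simp)]
  refine Finset.sup_congr rfl fun i _ => ?_
  simp only [Function.comp_apply]
  rw [← div_eq_mul_inv, ← ENNReal.div_rpow_of_nonneg _ _ hα.le, ENNReal.coe_div (ha i).ne']
  congr 1
  simp only [div_eq_mul_inv]
  rw [ENNReal.mul_inv (Or.inl hx') (Or.inl ENNReal.coe_ne_top),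
    inv_inv]
  ring

end ExtremalProcess

/-! ### Laws of extremal processes and independent decompositions -/

theorem equalInLaw_of_lowerBoxes {T Ω Ω' : Type*} [MeasurableSpace Ω] [MeasurableSpace Ω']
    {P : Measure Ω} [IsFiniteMeasure P] {P' : Measure Ω'} {Y : T → Ω → ℝ≥0∞} {Z : T → Ω' → ℝ≥0∞}
    (hY : ∀ t, Measurable (Y t)) (hZ : ∀ t, Measurable (Z t))
    (h : ∀ (I : Finset T) (c : T → ℝ≥0), (∀ t, 0 < c t) →
      P {ω | ∀ t ∈ I, Y t ω ≤ c t} = P' {ω | ∀ t ∈ I, Z t ω ≤ c t}) : EqualInLaw P P' Y Z := by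
  have hY' : Measurable fun ω t => Y t ω := measurable_pi_lambda _ hY
  have hZ' : Measurable fun ω t => Z t ω := measurable_pi_lambda _ hZ
  refine ⟨hY'.aemeasurable, hZ'.aemeasurable, ext_of_lowerBoxes fun I c hc => ?_⟩
  have hB := measurableSet_of_mem_lowerBoxes (T := T) ⟨I, c, hc, rfl⟩
  rw [Measure.map_apply hY' hB, Measure.map_apply hZ' hB]
  exact h I c hc

theorem iIndepFun_of_lowerBoxes {ι T Ω : Type*} [MeasurableSpace Ω] {P : Measure Ω}
    {Y : ι → T → Ω → ℝ≥0∞} (hY : ∀ j t, Measurable (Y j t))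
    (h : ∀ (J : Finset ι) (I : ι → Finset T) (c : ι → T → ℝ≥0), (∀ j t, 0 < c j t) →
      P {ω | ∀ j ∈ J, ∀ t ∈ I j, Y j t ω ≤ c j t} = ∏ j ∈ J, P {ω | ∀ t ∈ I j, Y j t ω ≤ c j t}) :
    iIndepFun (fun j ω t => Y j t ω) P := by
  classical
  rw [iIndepFun_iff_iIndep]
  have hY' : ∀ j, Measurable fun ω t => Y j t ω := fun j => measurable_pi_lambda _ (hY j)
  refine iIndepSets.iIndep (fun j => (hY' j).comap_le)
    (fun j => {s | ∃ B ∈ lowerBoxes T, (fun ω t => Y j t ω) ⁻¹' B = s})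
    (fun j => (isPiSystem_lowerBoxes T).comap _) (fun j => ?_) ?_
  · rw [← generateFrom_lowerBoxes, MeasurableSpace.comap_generateFrom]
    rfl
  · rw [iIndepSets_iff]
    intro J F hF
    have hF' : ∀ j, ∃ (I : Finset T) (c : T → ℝ≥0), (∀ t, 0 < c t) ∧
        (j ∈ J → F j = {ω | ∀ t ∈ I, Y j t ω ≤ c t}) := by
      intro j
      by_cases hj : j ∈ J
      · obtain ⟨_, ⟨I, c, hc, rfl⟩, hB⟩ := hF j hj
        exact ⟨I, c, hc, fun _ => hB.symm⟩
      · exact ⟨∅, fun _ => 1, by simp, fun h => (hj h).elim⟩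
    choose I c hc hFc using hF'
    have h1 := h J I c hc
    rw [Finset.prod_congr rfl fun j hj => congrArg P (hFc j hj), ← h1]
    congr 1
    ext ω
    simp only [mem_iInter, mem_ofPred_eq]
    refine forall₂_congr fun j hj => ?_
    rw [hFc j hj, mem_ofPred_eq]

theorem equalInLaw_extremalProcess {T S₁ Ω₁ S₂ Ω₂ : Type*} [MeasurableSpace T] [MeasurableSpace S₁]
    [MeasurableSpace Ω₁] [MeasurableSpace S₂] [MeasurableSpace Ω₂] {α : ℝ} (hα : 0 < α)
    {P₁ : Measure Ω₁} [IsProbabilityMeasure P₁] {P₂ : Measure Ω₂} [IsProbabilityMeasure P₂]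
    {μ₁ : Measure S₁} {μ₂ : Measure S₂} {M₁ : Set S₁ → Ω₁ → ℝ≥0∞} {M₂ : Set S₂ → Ω₂ → ℝ≥0∞}
    {f₁ : T → S₁ → ℝ≥0} {f₂ : T → S₂ → ℝ≥0} (hM₁ : IsFrechetSupMeasure P₁ α μ₁ M₁)
    (hM₂ : IsFrechetSupMeasure P₂ α μ₂ M₂) (hf₁ : Measurable (Function.uncurry f₁))
    (hf₂ : Measurable (Function.uncurry f₂)) {A₁ : Set S₁} {A₂ : Set S₂} (hA₁ : MeasurableSet A₁)
    (hA₂ : MeasurableSet A₂)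
    (h : ∀ I a, tilted μ₁ (powFamily α f₁) I a A₁ = tilted μ₂ (powFamily α f₂) I a A₂) :
    EqualInLaw P₁ P₂ (extremalProcess M₁ f₁ A₁) (extremalProcess M₂ f₂ A₂) := by
  refine equalInLaw_of_lowerBoxes (measurable_extremalProcess hM₁ A₁)
    (measurable_extremalProcess hM₂ A₂) fun I c hc => ?_
  rw [measure_extremalProcess_le hM₁ hα hf₁ hA₁ I c hc,
    measure_extremalProcess_le hM₂ hα hf₂ hA₂ I c hc, h]

namespace IsMeasurableRepresentation
variable {T S Ω Ω' : Type*} [MeasurableSpace T] [MeasurableSpace S]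
  [MeasurableSpace Ω] [MeasurableSpace Ω'] {α : ℝ} {P : Measure Ω} {X : T → Ω → ℝ≥0∞}
  {μ : Measure S} {f : T → S → ℝ≥0} {P' : Measure Ω'}
  {M : Set S → Ω' → ℝ≥0∞}

theorem isSpectralFamily (h : IsMeasurableRepresentation α P X μ f P' M) (hα : 0 < α) :
    IsSpectralFamily μ (powFamily α f) :=
  isSpectralFamily_powFamily hα h.measurable h.integrable

variable [IsProbabilityMeasure P']

/-- For an almost disjoint cover the tilted masses add up to the total, and `expNeg` turns the sum
into the product of the probabilities. -/
theorem isIndependentDecomposition (h : IsMeasurableRepresentation α P X μ f P' M) (hα : 0 < α)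
    {n : ℕ} {A : Fin n → Set S} (hA : ∀ j, MeasurableSet (A j)) (hc : μ (⋃ j, A j)ᶜ = 0)
    (hd : Pairwise fun j k => AEDisjoint μ (A j) (A k)) :
    IsIndependentDecomposition α P X P' (fun j => extremalProcess M f (A j)) where
  eqLaw := by
    refine IdentDistrib.trans h.eqLaw (equalInLaw_of_lowerBoxes
      (measurable_extremalProcess h.supMeasure univ)
      (fun t => Measurable.iSup fun j => measurable_extremalProcess h.supMeasure (A j) t)
      fun I c hpos => ?_)
    have hset : {ω | ∀ t ∈ I, ⨆ j, extremalProcess M f (A j) t ω ≤ c t}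
        = {ω | ∀ j ∈ (Finset.univ : Finset (Fin n)), ∀ t ∈ I, extremalProcess M f (A j) t ω ≤ c t} := by
      ext ω
      simp only [mem_ofPred_eq, iSup_le_iff, Finset.mem_univ, true_imp_iff]
      exact ⟨fun H j t ht => H t ht j, fun H t ht j => H j t ht⟩
    rw [hset, measure_forall_extremalProcess_le h.supMeasure hα h.measurable hA hd Finset.univ
      (fun _ => I) (fun _ => c) fun _ => hpos,
      measure_extremalProcess_le h.supMeasure hα h.measurable MeasurableSet.univ I c hpos]
    simp only [measure_extremalProcess_le h.supMeasure hα h.measurable (hA _) I c hpos]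
    rw [← expNeg_sum]
    congr 1
    have hU : tilted μ (powFamily α f) I (invPow α c) univ
        = tilted μ (powFamily α f) I (invPow α c) (⋃ j, A j) := by
      refine (measure_congr ?_).symm
      rw [ae_eq_univ]
      exact tilted_absolutelyContinuous hc
    rw [hU, measure_iUnion₀ (fun j k hjk => tilted_absolutelyContinuous (hd hjk))
      fun j => (hA j).nullMeasurableSet, tsum_fintype]
  indep := iIndepFun_of_lowerBoxes (fun j => measurable_extremalProcess h.supMeasure (A j))
    fun J I c hpos =>
      measure_forall_extremalProcess_le h.supMeasure hα h.measurable hA hd J I c hpos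
  frechet j := isFrechetProcess_extremalProcess h.supMeasure hα h.measurable h.integrable (hA j)

theorem expNeg_lintegral_maxLin (h : IsMeasurableRepresentation α P X μ f P' M) (hα : 0 < α)
    (I : Finset T) (c : T → ℝ≥0) (hc : ∀ t, 0 < c t) :
    expNeg (∫⁻ s, maxLin I (invPow α c) (fun t => powFamily α f t s) ∂μ)
      = P.map (fun ω t => X t ω) {x | ∀ t ∈ I, x t ≤ c t} := by
  have hB := measurableSet_of_mem_lowerBoxes (T := T) ⟨I, c, hc, rfl⟩
  rw [h.eqLaw.map_eq, Measure.map_apply_of_aemeasurable h.eqLaw.aemeasurable_snd hB, ← tilted_univ,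
    ← measure_extremalProcess_le h.supMeasure hα h.measurable MeasurableSet.univ I c hc]
  rfl

/-- The integrals of the max-linear combinations are determined by the law of the process. -/
theorem lintegral_maxLin_eq {S₂ Ω₂ : Type*} [MeasurableSpace S₂] [MeasurableSpace Ω₂]
    {μ₂ : Measure S₂} {f₂ : T → S₂ → ℝ≥0} {P₂ : Measure Ω₂} [IsProbabilityMeasure P₂]
    {M₂ : Set S₂ → Ω₂ → ℝ≥0∞} (h : IsMeasurableRepresentation α P X μ f P' M)
    (h₂ : IsMeasurableRepresentation α P X μ₂ f₂ P₂ M₂) (hα : 0 < α) (I : Finset T)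
    (a : T → ℝ≥0) :
    ∫⁻ s, maxLin I a (fun t => powFamily α f t s) ∂μ
      = ∫⁻ s, maxLin I a (fun t => powFamily α f₂ t s) ∂μ₂ := by
  classical
  -- `c t` solves `(c t) ^ (-α) = a t`. Indices with `a t = 0` are dropped from `I`, so the value
  -- `1` there only ensures positivity.
  let c : T → ℝ≥0 := fun t => if a t = 0 then 1 else ((a t) ^ (1 / α))⁻¹
  have hc : ∀ t, 0 < c t := by
    intro t
    simp only [c]
    split_ifs with h0
    · exact one_pos
    · exact inv_pos.2 (NNReal.rpow_pos (pos_iff_ne_zero.2 h0))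
  have hmax : ∀ x : T → ℝ≥0∞, maxLin I a x = maxLin (I.filter fun t => a t ≠ 0) (invPow α c) x := by
    intro x
    have hcoef : ∀ t, a t ≠ 0 → invPow α c t = a t := by
      intro t ht
      simp only [invPow, c, if_neg ht, inv_inv]
      rw [← NNReal.rpow_mul, one_div, inv_mul_cancel₀ hα.ne', NNReal.rpow_one]
    refine le_antisymm (Finset.sup_le fun t ht => ?_) (Finset.sup_le fun t ht => ?_)
    · by_cases h0 : a t = 0
      · simp [h0]
      · rw [← hcoef t h0]
        exact Finset.le_sup (f := fun t => (invPow α c t : ℝ≥0∞) * x t) (by simp [ht, h0])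
    · rw [Finset.mem_filter] at ht
      rw [hcoef t ht.2]
      exact Finset.le_sup (f := fun t => (a t : ℝ≥0∞) * x t) ht.1
  simp only [hmax]
  refine expNeg_injective ?_
  rw [h.expNeg_lintegral_maxLin hα _ c hc, h₂.expNeg_lintegral_maxLin hα _ c hc]

end IsMeasurableRepresentation

/-! ### Co-spectral functions and cones -/

section Cones
variable {T S : Type*} [MeasurableSpace T] [MeasurableSpace S] {lam : Measure T} {α : ℝ}

/-- `K` is closed under multiplication by positive scalars. -/
def IsPosScalarClosed (K : Set (T →ₘ[lam] ℝ≥0)) : Prop :=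
  ∀ c : ℝ≥0, c ≠ 0 → ∀ g ∈ K, c • g ∈ K

/-- The `α`-th power of an element of `K` is a version of `x`. -/
def IsPowOfMem (α : ℝ) (K : Set (T →ₘ[lam] ℝ≥0)) (x : T → ℝ≥0∞) : Prop :=
  ∃ g ∈ K, x =ᵐ[lam] fun t => (g t : ℝ≥0∞) ^ α

theorem IsPowOfMem.of_proportional (hα : 0 < α) {K : Set (T →ₘ[lam] ℝ≥0)}
    (hK : IsPosScalarClosed K) {x x' : T → ℝ≥0∞} (hx : Proportional lam x x')
    (h : IsPowOfMem α K x) : IsPowOfMem α K x' := by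
  obtain ⟨c, hc, hcx⟩ := hx
  obtain ⟨g, hg, hgx⟩ := h
  -- The factor `c` relates the `α`-th powers, so the functions differ by its `α`-th root.
  refine ⟨c ^ (1 / α) • g, hK _ (NNReal.rpow_pos (pos_iff_ne_zero.2 hc)).ne' g hg, ?_⟩
  filter_upwards [hcx, hgx, AEEqFun.coeFn_smul (c ^ (1 / α)) g] with t h1 h2 h3
  rw [h1, h2, h3, Pi.smul_apply, smul_eq_mul, ENNReal.coe_mul, ENNReal.mul_rpow_of_nonneg _ _ hα.le,
    ENNReal.coe_rpow_of_nonneg _ (by positivity), ← ENNReal.rpow_mul, one_div,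
    inv_mul_cancel₀ hα.ne', ENNReal.rpow_one]

theorem eq_of_ae_eq_rpow (hα : 0 < α) {g g' : T →ₘ[lam] ℝ≥0}
    (h : (fun t => (g t : ℝ≥0∞) ^ α) =ᵐ[lam] fun t => (g' t : ℝ≥0∞) ^ α) : g = g' := by
  refine AEEqFun.ext ?_
  filter_upwards [h] with t ht
  exact ENNReal.coe_injective ((ENNReal.rpow_left_injective hα.ne') ht)

theorem coSpectral_rpow {f : T → S → ℝ≥0} (hf : Measurable (Function.uncurry f)) (s : S) :
    (fun t => powFamily α f t s) =ᵐ[lam] fun t => (coSpectral lam hf s t : ℝ≥0∞) ^ α := by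
  filter_upwards [AEEqFun.coeFn_mk (fun t => f t s)
    (hf.comp (measurable_id.prodMk measurable_const)).aestronglyMeasurable] with t ht
  rw [coSpectral, ht, powFamily]

theorem isPowOfMem_iff (hα : 0 < α) {f : T → S → ℝ≥0} (hf : Measurable (Function.uncurry f)) (s : S)
    {K : Set (T →ₘ[lam] ℝ≥0)} :
    IsPowOfMem α K (fun t => powFamily α f t s) ↔ coSpectral lam hf s ∈ K := by
  constructor
  · rintro ⟨g, hg, h⟩
    rwa [eq_of_ae_eq_rpow hα ((coSpectral_rpow hf s).symm.trans h)]
  · exact fun h => ⟨_, h, coSpectral_rpow hf s⟩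

theorem powFamily_ae_eq_zero_iff (hα : 0 < α) {f : T → S → ℝ≥0}
    (hf : Measurable (Function.uncurry f)) (s : S) :
    (fun t => powFamily α f t s) =ᵐ[lam] 0 ↔ coSpectral lam hf s = 0 := by
  have h0 : (0 : T → ℝ≥0∞) =ᵐ[lam] fun t => ((0 : T →ₘ[lam] ℝ≥0) t : ℝ≥0∞) ^ α := by
    filter_upwards [AEEqFun.coeFn_zero (μ := lam) (β := ℝ≥0)] with t ht
    rw [ht]; simp [hα]
  constructor
  · exact fun h => eq_of_ae_eq_rpow hα ((coSpectral_rpow hf s).symm.trans (h.trans h0))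
  · intro h
    have := coSpectral_rpow (α := α) (lam := lam) hf s
    rw [h] at this
    exact this.trans h0.symm

end Cones

/-! ### Comparison of co-spectral decompositions. -/

section Decompositions
variable {T S₁ S₂ Ω Ω₁ Ω₂ : Type*} [MeasurableSpace T] [MeasurableSpace.CountablyGenerated T]
  {lam : Measure T} [SigmaFinite lam] [MeasurableSpace S₁]
  [MeasurableSpace S₂] [MeasurableSpace Ω] [MeasurableSpace Ω₁]
  [MeasurableSpace Ω₂] {α : ℝ} {P : Measure Ω} {X : T → Ω → ℝ≥0∞}
  {μ₁ : Measure S₁} {μ₂ : Measure S₂} [SFinite μ₁] [SFinite μ₂] {P₁ : Measure Ω₁} {P₂ : Measure Ω₂}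
  [IsProbabilityMeasure P₁] [IsProbabilityMeasure P₂]
  {M₁ : Set S₁ → Ω₁ → ℝ≥0∞} {M₂ : Set S₂ → Ω₂ → ℝ≥0∞} {f₁ : T → S₁ → ℝ≥0} {f₂ : T → S₂ → ℝ≥0}

/-- Components of co-spectral decompositions of two representations have the same laws. -/
theorem equalInLaw_of_isCoSpectralDecomposition [StandardBorelSpace S₁] [StandardBorelSpace S₂] (hα : 0 < α)
    (h₁ : IsMeasurableRepresentation α P X μ₁ f₁ P₁ M₁)
    (h₂ : IsMeasurableRepresentation α P X μ₂ f₂ P₂ M₂) {n : ℕ} {K : Fin n → Set (T →ₘ[lam] ℝ≥0)}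
    (hK : ∀ j, IsPosScalarClosed (K j)) {A₁ : Fin n → Set S₁} {A₂ : Fin n → Set S₂}
    (hA₁ : IsCoSpectralDecomposition μ₁ h₁.measurable K A₁)
    (hA₂ : IsCoSpectralDecomposition μ₂ h₂.measurable K A₂)
    (hd₁ : ∀ I a j k, j ≠ k → ∀ᵐ s ∂tilted μ₁ (powFamily α f₁) I a,
      ¬ (coSpectral lam h₁.measurable s ∈ K j ∧ coSpectral lam h₁.measurable s ∈ K k))
    (hd₂ : ∀ I a j k, j ≠ k → ∀ᵐ s ∂tilted μ₂ (powFamily α f₂) I a,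
      ¬ (coSpectral lam h₂.measurable s ∈ K j ∧ coSpectral lam h₂.measurable s ∈ K k)) (j : Fin n) :
    EqualInLaw P₁ P₂ (extremalProcess M₁ f₁ (A₁ j)) (extremalProcess M₂ f₂ (A₂ j)) := by
  refine equalInLaw_extremalProcess hα h₁.supMeasure h₂.supMeasure h₁.measurable h₂.measurable
    (hA₁.measurableSet j) (hA₂.measurableSet j) fun I a => ?_
  refine tilted_eq_of_proportional (lam := lam) (h₁.isSpectralFamily hα) (h₂.isSpectralFamily hα)
    (h₁.lintegral_maxLin_eq h₂ hα) I a (fun j => IsPowOfMem α (K j))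
    (fun j x x' hx hj => hj.of_proportional hα (hK j) hx) hA₁.measurableSet hA₁.cover
    (fun j s hs => (isPowOfMem_iff hα h₁.measurable s).2 (hA₁.mem j s hs)) ?_ hA₂.measurableSet
    hA₂.cover (fun j s hs => (isPowOfMem_iff hα h₂.measurable s).2 (hA₂.mem j s hs)) ?_ j
  · simpa only [isPowOfMem_iff hα h₁.measurable] using hd₁ I a
  · simpa only [isPowOfMem_iff hα h₂.measurable] using hd₂ I a

/-- A co-spectral decomposition of one representation yields one of the other representation, up to
points where the latter vanishes. -/
theorem exists_coSpectral_cover [StandardBorelSpace S₁] (hα : 0 < α) (h₁ : IsMeasurableRepresentation α P X μ₁ f₁ P₁ M₁)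
    (h₂ : IsMeasurableRepresentation α P X μ₂ f₂ P₂ M₂) {n : ℕ} {K : Fin n → Set (T →ₘ[lam] ℝ≥0)}
    (hK : ∀ j, IsPosScalarClosed (K j)) {A₁ : Fin n → Set S₁}
    (hA₁ : IsCoSpectralDecomposition μ₁ h₁.measurable K A₁) :
    ∃ B : Fin n → Set S₂, (∀ j, MeasurableSet (B j)) ∧
      (∀ j, ∀ s ∈ B j, coSpectral lam h₂.measurable s ∈ K j) ∧
      ∀ t, ∀ᵐ s ∂μ₂, s ∉ ⋃ j, B j → f₂ t s = 0 := by
  obtain ⟨B, hBm, hB, hB0⟩ := exists_transfer_cover (lam := lam) (h₁.isSpectralFamily hα)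
    (h₂.isSpectralFamily hα) (h₁.lintegral_maxLin_eq h₂ hα) hA₁.measurableSet hA₁.cover
  refine ⟨B, hBm, fun j s' hs' => ?_, fun t => ?_⟩
  · obtain ⟨s, hs, hp⟩ := hB j s' hs'
    rw [← isPowOfMem_iff hα]
    exact ((isPowOfMem_iff hα h₁.measurable s).2 (hA₁.mem j s hs)).of_proportional hα (hK j) hp
  · filter_upwards [hB0 t] with s hs hsB
    simpa [powFamily, hα, hα.ne'] using hs hsB

/-- Non-trivial co-spectral functions are a property of the process. -/
theorem ae_tilted_coSpectral_ne_zero [StandardBorelSpace S₂] (hα : 0 < α)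
    (h₁ : IsMeasurableRepresentation α P X μ₁ f₁ P₁ M₁)
    (h₂ : IsMeasurableRepresentation α P X μ₂ f₂ P₂ M₂)
    (h0 : ∀ᵐ s ∂μ₁, coSpectral lam h₁.measurable s ≠ 0) (I : Finset T) (a : T → ℝ≥0) :
    ∀ᵐ s ∂tilted μ₂ (powFamily α f₂) I a, coSpectral lam h₂.measurable s ≠ 0 := by
  have := ae_tilted_ne_zero (lam := lam) (h₁.isSpectralFamily hα) (h₂.isSpectralFamily hα)
    (h₁.lintegral_maxLin_eq h₂ hα) I a
    (by simpa only [powFamily_ae_eq_zero_iff hα h₁.measurable] using h0)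
  simpa only [powFamily_ae_eq_zero_iff hα h₂.measurable] using this

end Decompositions

/-- If every `f t` vanishes on `E`, so does every max-linear `g`, and its distance to `f₀` is at
least `∫_E f₀ ^ α`. Approximation forces this integral to vanish, while `f₀` is positive almost
everywhere. -/
theorem HasFullSupport.measure_eq_zero {T S : Type*} [MeasurableSpace S] {α : ℝ} (hα : 0 < α)
    {μ : Measure S} {f : T → S → ℝ≥0} (h : HasFullSupport α μ f) {E : Set S} (hE : MeasurableSet E)
    (h0 : ∀ t, ∀ᵐ s ∂μ, s ∈ E → f t s = 0) : μ E = 0 := by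
  obtain ⟨f₀, hf₀, -, happrox, hsupp⟩ := h
  have hint : ∫⁻ s in E, (f₀ s : ℝ≥0∞) ^ α ∂μ = 0 := by
    refine le_antisymm (le_of_forall_pos_le_add fun ε hε => ?_) zero_le
    obtain ⟨g, ⟨m, a, t, -, rfl⟩, hg⟩ := happrox ε hε
    rw [zero_add]
    refine le_trans ?_ hg.le
    rw [rhoDist]
    refine le_trans ?_ (setLIntegral_le_lintegral E _)
    refine lintegral_mono_ae ?_
    have hz : ∀ᵐ s ∂μ, ∀ i, s ∈ E → f (t i) s = 0 := ae_all_iff.2 fun i => h0 (t i)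
    filter_upwards [ae_restrict_of_ae hz, ae_restrict_mem hE] with s hs hsE
    have : (Finset.univ.sup fun i => a i * f (t i) s) = 0 := by
      refine le_antisymm (Finset.sup_le fun i _ => ?_) zero_le
      rw [hs i hsE, mul_zero]
    rw [this, NNReal.zero_rpow hα.ne', edist_comm, edist_nndist, ← ENNReal.coe_rpow_of_nonneg _ hα.le,
      ENNReal.coe_le_coe]
    refine le_of_eq ?_
    ext
    simp
  have hm : Measurable fun s => (f₀ s : ℝ≥0∞) ^ α :=
    (measurable_coe_nnreal_ennreal.comp hf₀).pow_const α
  rw [lintegral_eq_zero_iff hm] at hint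
  have h1 : ∀ᵐ s ∂μ, s ∈ E → f₀ s = 0 := by
    have := (ae_restrict_iff' hE).1 hint
    filter_upwards [this] with s hs hsE
    simpa [hα, hα.ne'] using hs hsE
  refine measure_mono_null (fun s hs => ?_) (measure_union_null hsupp (ae_iff.1 h1))
  by_cases hz : f₀ s = 0
  · exact Or.inl hz
  · exact Or.inr fun H => hz (H hs)

/-! ### The conservative, dissipative, positive and null cones. -/

section Cones
variable {T S : Type*} [MeasurableSpace T] [MeasurableSpace S] {lam : Measure T} {α : ℝ}

theorem lintegral_mul_smul_rpow (hα : 0 < α) (w : T → ℝ≥0) (c : ℝ≥0) (g : T →ₘ[lam] ℝ≥0) :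
    ∫⁻ t, (w t : ℝ≥0∞) * ((c • g) t : ℝ≥0∞) ^ α ∂lam
      = (c : ℝ≥0∞) ^ α * ∫⁻ t, (w t : ℝ≥0∞) * (g t : ℝ≥0∞) ^ α ∂lam := by
  rw [← lintegral_const_mul' _ _ (ENNReal.rpow_ne_top_of_nonneg hα.le ENNReal.coe_ne_top)]
  refine lintegral_congr_ae ?_
  filter_upwards [AEEqFun.coeFn_smul c g] with t ht
  rw [ht, Pi.smul_apply, smul_eq_mul, ENNReal.coe_mul, ENNReal.mul_rpow_of_nonneg _ _ hα.le]
  ring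

theorem lintegral_smul_rpow (hα : 0 < α) (c : ℝ≥0) (g : T →ₘ[lam] ℝ≥0) :
    ∫⁻ t, ((c • g) t : ℝ≥0∞) ^ α ∂lam = (c : ℝ≥0∞) ^ α * ∫⁻ t, (g t : ℝ≥0∞) ^ α ∂lam := by
  simpa using lintegral_mul_smul_rpow hα (fun _ => 1) c g

theorem coe_rpow_ne_zero {c : ℝ≥0} (hc : c ≠ 0) : (c : ℝ≥0∞) ^ α ≠ 0 := by
  simp [hc]

theorem lintegral_coSpectral_rpow (f : T → S → ℝ≥0) (hf : Measurable (Function.uncurry f)) (s : S) :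
    ∫⁻ t, (coSpectral lam hf s t : ℝ≥0∞) ^ α ∂lam = ∫⁻ t, (f t s : ℝ≥0∞) ^ α ∂lam :=
  (lintegral_congr_ae (coSpectral_rpow hf s)).symm

theorem isPosScalarClosed_positiveCone (hα : 0 < α) (𝒲 : Set (T → ℝ≥0)) :
    IsPosScalarClosed (positiveCone α lam 𝒲) := by
  intro c hc g hg w hw
  rw [lintegral_mul_smul_rpow hα, hg w hw, ENNReal.mul_top (coe_rpow_ne_zero hc)]

theorem isPosScalarClosed_nullCone (hα : 0 < α) (𝒲 : Set (T → ℝ≥0)) :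
    IsPosScalarClosed (nullCone α lam 𝒲) := by
  rintro c hc g (hg | hg)
  · rw [mem_singleton_iff.1 hg, smul_zero]
    exact Or.inl rfl
  · refine Or.inr fun h => hg ?_
    have := isPosScalarClosed_positiveCone hα 𝒲 c⁻¹ (inv_ne_zero hc) _ h
    rwa [smul_smul, inv_mul_cancel₀ hc, one_smul] at this

theorem disjoint_positiveCone_nullCone (hα : 0 < α) {𝒲 : Set (T → ℝ≥0)} (h𝒲 : 𝒲.Nonempty) :
    Disjoint (positiveCone α lam 𝒲) (nullCone α lam 𝒲) := by
  rw [disjoint_left]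
  rintro g hg (h0 | h0)
  · obtain ⟨w, hw⟩ := h𝒲
    have h1 := hg w hw
    have h2 : ∫⁻ t, (w t : ℝ≥0∞) * (g t : ℝ≥0∞) ^ α ∂lam = 0 := by
      rw [mem_singleton_iff.1 h0]
      refine (lintegral_congr_ae ?_).trans lintegral_zero
      filter_upwards [AEEqFun.coeFn_zero (μ := lam) (β := ℝ≥0)] with t ht
      rw [ht]
      simp [hα]
    rw [h2] at h1
    exact ENNReal.zero_ne_top h1
  · exact h0 hg

end Cones

theorem measurableSet_consDissSets {T S : Type*} [MeasurableSpace T] [MeasurableSpace S]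
    {lam : Measure T} [SFinite lam] {α : ℝ} {f : T → S → ℝ≥0}
    (hf : Measurable (Function.uncurry f)) (j : Fin 2) :
    MeasurableSet (consDissSets α lam f j) := by
  have hm : Measurable fun s => ∫⁻ t, (f t s : ℝ≥0∞) ^ α ∂lam :=
    ((measurable_coe_nnreal_ennreal.comp hf).pow_const α).lintegral_prod_left'
  fin_cases j
  · exact hm (measurableSet_singleton ∞)
  · exact measurableSet_lt hm measurable_const

/-- Leaving `0` out of the conservative cone makes the two classes strictly disjoint. They remain
closed under positive scalars, which is all that the comparison needs, and no non-triviality of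
co-spectral functions is required. -/
theorem isCoSpectralDecomposition_consDissSets {T S : Type*} [MeasurableSpace T] [MeasurableSpace S]
    {lam : Measure T} [SFinite lam] {α : ℝ} {μ : Measure S}
    {f : T → S → ℝ≥0} (hf : Measurable (Function.uncurry f)) :
    IsCoSpectralDecomposition μ hf
      ![{g : T →ₘ[lam] ℝ≥0 | ∫⁻ t, (g t : ℝ≥0∞) ^ α ∂lam = ∞}, dissipativeCone α lam]
      (consDissSets α lam f) where
  measurableSet := measurableSet_consDissSets hf
  mem := by
    intro j s hs
    fin_cases j
    · exact (lintegral_coSpectral_rpow f hf s).trans hs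
    · exact (lintegral_coSpectral_rpow f hf s).trans_lt hs
  cover := by
    have : ⋃ j, consDissSets α lam f j = univ := by
      refine eq_univ_of_forall fun s => mem_iUnion.2 ?_
      rcases eq_or_ne (∫⁻ t, (f t s : ℝ≥0∞) ^ α ∂lam) ∞ with h | h
      · exact ⟨0, h⟩
      · exact ⟨1, h.lt_top⟩
    rw [this, compl_univ, measure_empty]

/-! ### The three decompositions. -/

section Main
variable {T S₁ S₂ Ω Ω₁ Ω₂ : Type*} [MeasurableSpace T] [MeasurableSpace.CountablyGenerated T]
  {lam : Measure T} [SigmaFinite lam] [MeasurableSpace S₁] [StandardBorelSpace S₁]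
  [MeasurableSpace S₂] [StandardBorelSpace S₂] [MeasurableSpace Ω] [MeasurableSpace Ω₁]
  [MeasurableSpace Ω₂] {α : ℝ} {P : Measure Ω} {X : T → Ω → ℝ≥0∞}
  {μ₁ : Measure S₁} {μ₂ : Measure S₂} [SFinite μ₁] [SFinite μ₂] {P₁ : Measure Ω₁} {P₂ : Measure Ω₂}
  [IsProbabilityMeasure P₁] [IsProbabilityMeasure P₂]
  {M₁ : Set S₁ → Ω₁ → ℝ≥0∞} {M₂ : Set S₂ → Ω₂ → ℝ≥0∞} {f₁ : T → S₁ → ℝ≥0} {f₂ : T → S₂ → ℝ≥0}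

/-- The cones meet only in `0`, so non-triviality makes the pieces almost disjoint; it passes to the
second representation under the tilted measures. Full support of the second representation turns the
transferred sets, which miss only points where each `f₂ t` vanishes, into a cover. -/
theorem coSpectral_decomposition (hα : 0 < α) (h₁ : IsMeasurableRepresentation α P X μ₁ f₁ P₁ M₁)
    (h₂ : IsMeasurableRepresentation α P X μ₂ f₂ P₂ M₂) {n : ℕ} {K : Fin n → Set (T →ₘ[lam] ℝ≥0)}
    (hK : ∀ j, IsPositiveCone (K j)) (hKd : ∀ j k, j ≠ k → K j ∩ K k = {0})
    (hsupp : HasFullSupport α μ₂ f₂)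
    (h0 : 2 ≤ n → ∀ᵐ s ∂μ₁, coSpectral lam h₁.measurable s ≠ 0) {A₁ : Fin n → Set S₁}
    (hA₁ : IsCoSpectralDecomposition μ₁ h₁.measurable K A₁) :
    IsIndependentDecomposition α P X P₁ (fun j => extremalProcess M₁ f₁ (A₁ j)) ∧
      (∃ A₂ : Fin n → Set S₂, IsCoSpectralDecomposition μ₂ h₂.measurable K A₂) ∧
      ∀ A₂ : Fin n → Set S₂, IsCoSpectralDecomposition μ₂ h₂.measurable K A₂ →
        ∀ j, EqualInLaw P₁ P₂ (extremalProcess M₁ f₁ (A₁ j)) (extremalProcess M₂ f₂ (A₂ j)) := by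
  have hKc : ∀ j, IsPosScalarClosed (K j) := fun j c _ g hg => hK j c g hg
  have h0' : ∀ j k : Fin n, j ≠ k → ∀ᵐ s ∂μ₁, coSpectral lam h₁.measurable s ≠ 0 :=
    fun j k hjk => h0 (by have := Fin.val_ne_of_ne hjk; omega)
  have hzero : ∀ j k, j ≠ k → ∀ g : T →ₘ[lam] ℝ≥0, g ∈ K j ∧ g ∈ K k → g = 0 := by
    intro j k hjk g hg
    have : g ∈ K j ∩ K k := hg
    rwa [hKd j k hjk] at this
  refine ⟨h₁.isIndependentDecomposition hα hA₁.measurableSet hA₁.cover fun j k hjk => ?_, ?_, ?_⟩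
  · refine measure_eq_zero_iff_ae_notMem.2 ?_
    filter_upwards [h0' j k hjk] with s hs hmem
    exact hs (hzero j k hjk _ ⟨hA₁.mem j s hmem.1, hA₁.mem k s hmem.2⟩)
  · obtain ⟨B, hBm, hB, hB0⟩ := exists_coSpectral_cover hα h₁ h₂ hKc hA₁
    exact ⟨B, hBm, hB, hsupp.measure_eq_zero hα (MeasurableSet.iUnion hBm).compl hB0⟩
  · intro A₂ hA₂ j
    refine equalInLaw_of_isCoSpectralDecomposition hα h₁ h₂ hKc hA₁ hA₂ (fun I a j k hjk => ?_)
      (fun I a j k hjk => ?_) j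
    · filter_upwards [tilted_absolutelyContinuous.ae_le (h0' j k hjk)] with s hs hmem
      exact hs (hzero j k hjk _ hmem)
    · filter_upwards [ae_tilted_coSpectral_ne_zero hα h₁ h₂ (h0' j k hjk) I a] with s hs hmem
      exact hs (hzero j k hjk _ hmem)

theorem conservative_dissipative_decomposition (hα : 0 < α)
    (h₁ : IsMeasurableRepresentation α P X μ₁ f₁ P₁ M₁)
    (h₂ : IsMeasurableRepresentation α P X μ₂ f₂ P₂ M₂) :
    IsCoSpectralDecomposition μ₁ h₁.measurable
        ![conservativeCone α lam, dissipativeCone α lam] (consDissSets α lam f₁) ∧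
      IsIndependentDecomposition α P X P₁
        (fun j => extremalProcess M₁ f₁ (consDissSets α lam f₁ j)) ∧
      ∀ j, EqualInLaw P₁ P₂ (extremalProcess M₁ f₁ (consDissSets α lam f₁ j))
        (extremalProcess M₂ f₂ (consDissSets α lam f₂ j)) := by
  have hD₁ := isCoSpectralDecomposition_consDissSets (α := α) (lam := lam) (μ := μ₁) h₁.measurable
  have hD₂ := isCoSpectralDecomposition_consDissSets (α := α) (lam := lam) (μ := μ₂) h₂.measurable
  have hdisj : ∀ j k : Fin 2, j ≠ k → ∀ g : T →ₘ[lam] ℝ≥0,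
      ¬ (g ∈ ![{g : T →ₘ[lam] ℝ≥0 | ∫⁻ t, (g t : ℝ≥0∞) ^ α ∂lam = ∞}, dissipativeCone α lam] j ∧
        g ∈ ![{g : T →ₘ[lam] ℝ≥0 | ∫⁻ t, (g t : ℝ≥0∞) ^ α ∂lam = ∞}, dissipativeCone α lam] k) := by
    have hne : ∀ g : T →ₘ[lam] ℝ≥0, ∫⁻ t, (g t : ℝ≥0∞) ^ α ∂lam = ∞ → g ∉ dissipativeCone α lam :=
      fun g h1 h2 => (show ∫⁻ t, (g t : ℝ≥0∞) ^ α ∂lam < ∞ from h2).ne h1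
    intro j k hjk g ⟨hj, hk⟩
    fin_cases j <;> fin_cases k
    · exact hjk rfl
    · exact hne g hj hk
    · exact hne g hk hj
    · exact hjk rfl
  refine ⟨⟨hD₁.measurableSet, ?_, hD₁.cover⟩, ?_, ?_⟩
  · intro j s hs
    have := hD₁.mem j s hs
    fin_cases j
    · exact Or.inr this
    · exact this
  · refine h₁.isIndependentDecomposition hα hD₁.measurableSet hD₁.cover fun j k hjk => ?_
    refine (disjoint_left.2 fun s hj hk => ?_ : Disjoint _ _).aedisjoint
    exact hdisj j k hjk _ ⟨hD₁.mem j s hj, hD₁.mem k s hk⟩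
  · refine equalInLaw_of_isCoSpectralDecomposition hα h₁ h₂ (fun j => ?_) hD₁ hD₂
      (fun I a j k hjk => ae_of_all _ fun s => hdisj j k hjk _)
      (fun I a j k hjk => ae_of_all _ fun s => hdisj j k hjk _)
    fin_cases j
    · intro c hc g hg
      have hg : ∫⁻ t, (g t : ℝ≥0∞) ^ α ∂lam = ∞ := hg
      refine (lintegral_smul_rpow hα c g).trans ?_
      rw [hg, ENNReal.mul_top (coe_rpow_ne_zero hc)]
    · intro c _ g hg
      refine (lintegral_smul_rpow hα c g).trans_lt ?_
      exact ENNReal.mul_lt_top (ENNReal.rpow_lt_top_of_nonneg hα.le ENNReal.coe_ne_top) hg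

/-- A weight in `𝒲` excludes `0` from the positive cone, so the two cones are strictly disjoint.
Points missed by the transfer have trivial co-spectral function and go to the null part, which
replaces full support. -/
theorem positive_null_decomposition (hα : 0 < α)
    (h₁ : IsMeasurableRepresentation α P X μ₁ f₁ P₁ M₁)
    (h₂ : IsMeasurableRepresentation α P X μ₂ f₂ P₂ M₂) {𝒲 : Set (T → ℝ≥0)} (h𝒲 : 𝒲.Nonempty)
    {A₁ : Fin 2 → Set S₁} (hA₁ : IsCoSpectralDecomposition μ₁ h₁.measurable
      ![positiveCone α lam 𝒲, nullCone α lam 𝒲] A₁) :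
    IsIndependentDecomposition α P X P₁ (fun j => extremalProcess M₁ f₁ (A₁ j)) ∧
      (∃ A₂ : Fin 2 → Set S₂, IsCoSpectralDecomposition μ₂ h₂.measurable
        ![positiveCone α lam 𝒲, nullCone α lam 𝒲] A₂) ∧
      ∀ A₂ : Fin 2 → Set S₂, IsCoSpectralDecomposition μ₂ h₂.measurable
          ![positiveCone α lam 𝒲, nullCone α lam 𝒲] A₂ →
        ∀ j, EqualInLaw P₁ P₂ (extremalProcess M₁ f₁ (A₁ j)) (extremalProcess M₂ f₂ (A₂ j)) := by
  have hK : ∀ j, IsPosScalarClosed (![positiveCone α lam 𝒲, nullCone α lam 𝒲] j) := by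
    intro j
    fin_cases j
    · exact isPosScalarClosed_positiveCone hα 𝒲
    · exact isPosScalarClosed_nullCone hα 𝒲
  have hdisj : ∀ j k : Fin 2, j ≠ k → ∀ g : T →ₘ[lam] ℝ≥0,
      ¬ (g ∈ ![positiveCone α lam 𝒲, nullCone α lam 𝒲] j ∧
        g ∈ ![positiveCone α lam 𝒲, nullCone α lam 𝒲] k) := by
    have hne := disjoint_left.1 (disjoint_positiveCone_nullCone (lam := lam) hα h𝒲)
    intro j k hjk g ⟨hj, hk⟩
    fin_cases j <;> fin_cases k
    · exact hjk rfl
    · exact hne hj hk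
    · exact hne hk hj
    · exact hjk rfl
  refine ⟨?_, ?_, fun A₂ hA₂ => ?_⟩
  · refine h₁.isIndependentDecomposition hα hA₁.measurableSet hA₁.cover fun j k hjk => ?_
    refine (disjoint_left.2 fun s hj hk => ?_ : Disjoint _ _).aedisjoint
    exact hdisj j k hjk _ ⟨hA₁.mem j s hj, hA₁.mem k s hk⟩
  · obtain ⟨B, hBm, hB, hB0⟩ := exists_coSpectral_cover hα h₁ h₂ hK hA₁
    let Z : Set S₂ := {s | coSpectral lam h₂.measurable s = 0}
    have hZ : Z = {s | ∫⁻ t, powFamily α f₂ t s ∂lam = 0} := by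
      ext s
      change coSpectral lam h₂.measurable s = 0 ↔ ∫⁻ t, powFamily α f₂ t s ∂lam = 0
      rw [← powFamily_ae_eq_zero_iff hα, lintegral_eq_zero_iff]
      exact (h₂.isSpectralFamily hα).measurable.comp measurable_prodMk_right
    have hZm : MeasurableSet Z := by
      rw [hZ]
      exact ((h₂.isSpectralFamily hα).measurable.lintegral_prod_left') (measurableSet_singleton 0)
    have hcover : ∀ᵐ s ∂μ₂, s ∉ ⋃ j, B j → s ∈ Z := by
      have hm : MeasurableSet {p : T × S₂ | p.2 ∉ ⋃ j, B j → f₂ p.1 p.2 = 0} := by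
        have : {p : T × S₂ | p.2 ∉ ⋃ j, B j → f₂ p.1 p.2 = 0}
            = (Prod.snd ⁻¹' ⋃ j, B j) ∪ Function.uncurry f₂ ⁻¹' {0} := by
          ext p
          simp only [mem_ofPred_eq, mem_union, mem_preimage, mem_singleton_iff, Function.uncurry]
          tauto
        rw [this]
        exact (measurable_snd (MeasurableSet.iUnion hBm)).union
          (h₂.measurable (measurableSet_singleton 0))
      -- For each `t` the vanishing holds off a null set depending on `t`; Fubini turns this into
      -- vanishing at `lam`-almost every `t`, for almost every `s`.
      filter_upwards [(Measure.ae_ae_comm (μ := lam) (ν := μ₂)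
        (p := fun t s => s ∉ ⋃ j, B j → f₂ t s = 0) hm).1 (ae_of_all _ hB0)] with s hs hsB
      refine (powFamily_ae_eq_zero_iff hα h₂.measurable s).1 ?_
      filter_upwards [hs] with t ht
      simp [powFamily, ht hsB, hα]
    refine ⟨![B 0, B 1 ∪ Z], fun j => ?_, fun j s hs => ?_, ?_⟩
    · fin_cases j
      · exact hBm 0
      · exact (hBm 1).union hZm
    · fin_cases j
      · exact hB 0 s hs
      · rcases hs with hs | hs
        · exact hB 1 s hs
        · exact Or.inl hs
    · refine measure_eq_zero_iff_ae_notMem.2 ?_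
      filter_upwards [hcover] with s hs hmem
      refine hmem (mem_iUnion.2 ?_)
      by_cases hsB : s ∈ ⋃ j, B j
      · obtain ⟨j, hj⟩ := mem_iUnion.1 hsB
        fin_cases j
        · exact ⟨0, hj⟩
        · exact ⟨1, Or.inl hj⟩
      · exact ⟨1, Or.inr (hs hsB)⟩
  · exact equalInLaw_of_isCoSpectralDecomposition hα h₁ h₂ hK hA₁ hA₂
      (fun I a j k hjk => ae_of_all _ fun s => hdisj j k hjk _)
      (fun I a j k hjk => ae_of_all _ fun s => hdisj j k hjk _)

end Main

end FrechetProcess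

end

open FrechetProcess in
theorem theorem5p2
    {T : Type*} [MetricSpace T] [TopologicalSpace.SeparableSpace T] [MeasurableSpace T]
    [BorelSpace T] (lam : Measure T) [SigmaFinite lam] {α : ℝ} (hα : 0 < α)
    -- the process
    {Ω : Type*} [MeasurableSpace Ω] (P : Measure Ω) [IsProbabilityMeasure P]
    (X : T → Ω → ℝ≥0∞) (hX : IsFrechetProcess P α X)
    -- two arbitrary jointly measurable spectral representations of it
    {S₁ : Type*} [MeasurableSpace S₁] [StandardBorelSpace S₁] (μ₁ : Measure S₁) [SigmaFinite μ₁]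
    {Ω₁ : Type*} [MeasurableSpace Ω₁] (P₁ : Measure Ω₁) [IsProbabilityMeasure P₁]
    (M₁ : Set S₁ → Ω₁ → ℝ≥0∞) (f₁ : T → S₁ → ℝ≥0)
    (h₁ : IsMeasurableRepresentation α P X μ₁ f₁ P₁ M₁)
    {S₂ : Type*} [MeasurableSpace S₂] [StandardBorelSpace S₂] (μ₂ : Measure S₂) [SigmaFinite μ₂]
    {Ω₂ : Type*} [MeasurableSpace Ω₂] (P₂ : Measure Ω₂) [IsProbabilityMeasure P₂]
    (M₂ : Set S₂ → Ω₂ → ℝ≥0∞) (f₂ : T → S₂ → ℝ≥0)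
    (h₂ : IsMeasurableRepresentation α P X μ₂ f₂ P₂ M₂) :
    -- the general co-spectral decomposition
    (∀ (n : ℕ) (K : Fin n → Set (T →ₘ[lam] ℝ≥0)),
      (∀ j, IsPositiveCone (K j)) → (∀ j k, j ≠ k → K j ∩ K k = {0}) →
      HasFullSupport α μ₁ f₁ → HasFullSupport α μ₂ f₂ →
      (2 ≤ n → ∀ᵐ s ∂μ₁, coSpectral lam h₁.measurable s ≠ 0) →
      ∀ A₁ : Fin n → Set S₁, IsCoSpectralDecomposition μ₁ h₁.measurable K A₁ →
        IsIndependentDecomposition α P X P₁ (fun j => extremalProcess M₁ f₁ (A₁ j)) ∧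
        (∃ A₂ : Fin n → Set S₂, IsCoSpectralDecomposition μ₂ h₂.measurable K A₂) ∧
        ∀ A₂ : Fin n → Set S₂, IsCoSpectralDecomposition μ₂ h₂.measurable K A₂ →
          ∀ j, EqualInLaw P₁ P₂ (extremalProcess M₁ f₁ (A₁ j)) (extremalProcess M₂ f₂ (A₂ j))) ∧
    -- the conservative-dissipative decomposition
    (IsCoSpectralDecomposition μ₁ h₁.measurable
        ![conservativeCone α lam, dissipativeCone α lam] (consDissSets α lam f₁) ∧
      IsIndependentDecomposition α P X P₁
        (fun j => extremalProcess M₁ f₁ (consDissSets α lam f₁ j)) ∧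
      ∀ j, EqualInLaw P₁ P₂ (extremalProcess M₁ f₁ (consDissSets α lam f₁ j))
        (extremalProcess M₂ f₂ (consDissSets α lam f₂ j))) ∧
    -- the positive-null decomposition, for `T = ℝ`, `T = ℤ` or another ordered abelian group
    (∀ [AddCommGroup T] [LinearOrder T] [IsOrderedAddMonoid T] (𝒲 : Set (T → ℝ≥0)),
      𝒲 = decreasingWeights lam ∨ 𝒲 = increasingWeights lam → 𝒲.Nonempty →
      ∀ A₁ : Fin 2 → Set S₁,
        IsCoSpectralDecomposition μ₁ h₁.measurable ![positiveCone α lam 𝒲, nullCone α lam 𝒲] A₁ →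
        IsIndependentDecomposition α P X P₁ (fun j => extremalProcess M₁ f₁ (A₁ j)) ∧
        (∃ A₂ : Fin 2 → Set S₂, IsCoSpectralDecomposition μ₂ h₂.measurable
          ![positiveCone α lam 𝒲, nullCone α lam 𝒲] A₂) ∧
        ∀ A₂ : Fin 2 → Set S₂, IsCoSpectralDecomposition μ₂ h₂.measurable
            ![positiveCone α lam 𝒲, nullCone α lam 𝒲] A₂ →
          ∀ j, EqualInLaw P₁ P₂ (extremalProcess M₁ f₁ (A₁ j))
            (extremalProcess M₂ f₂ (A₂ j))) := by
  -- Second countability makes the Borel `σ`-algebra of `T` countably generated, as the coordinates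
  -- in the Hilbert cube require.
  have := UniformSpace.secondCountable_of_separable T
  refine ⟨fun n K hK hKd _ hsupp₂ h0 A₁ hA₁ => coSpectral_decomposition hα h₁ h₂ hK hKd hsupp₂ h0 hA₁,
    conservative_dissipative_decomposition hα h₁ h₂, ?_⟩
  intro _ _ _ 𝒲 _ h𝒲 A₁ hA₁
  exact positive_null_decomposition hα h₁ h₂ h𝒲 hA₁
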